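/- For $n\ge 1$ an $n$-permutation is a word $\pi=\pi_1\cdots\pi_n$ containing each letter of $\{1,\dots,n\}$ exactly once. For a classical pattern $\sigma$, $S_n(\sigma)$ is the set of $n$-permutations avoiding $\sigma$, and $\mathrm{Av}(\sigma)=\bigcup_{n\ge1}S_n(\sigma)$. For a vincular pattern $\sigma$, in which underlined neighbouring letters must be matched by neighbouring positions, $\sigma(\pi)$ is the number of occurrences of $\sigma$ in $\pi$. Let $$\mathrm{bast}=\underline{13}2+\underline{21}3+\underline{32}1+\underline{21},\qquad \mathrm{foze}=\underline{21}3+3\underline{21}+\underline{13}2+\underline{21},$$ and let $r(\pi)=\pi_n\cdots\pi_1$ and $c(\pi)=(n+1-\pi_1)\cdots(n+1-\pi_n)$ be the reverse and the complement. The map $\theta$ on $\mathrm{Av}(231)$ is defined as follows. Let first $\pi\in S_n(231)$ begin with its largest letter $n$. An inverse descent run of $\pi$ is a set of positions of $\pi$ of the form $\{\pi^{-1}_i,\pi^{-1}_{i+1},\dots,\pi^{-1}_j\}$, where $\{i,i+1,\dots,j\}$ is a maximal interval with $\pi^{-1}_i>\pi^{-1}_{i+1}>\dots>\pi^{-1}_j$.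 Let $I_1,\dots,I_k$ be the inverse descent runs of $\pi$, ordered so that $\max I_1>\dots>\max I_k$, let $c_t=|I_t|$, and let $M=\{i<n:\pi_i<\pi_{i+1}\}$ be the ascent set of $\pi$. Start with two empty stacks $\mathscr A$, $\mathscr B$. For $t=1,\dots,k$ in turn: push the next $c_t$ letters of the sequence $n,n-1,\dots,1$ onto $\mathscr A$; then, as long as $\mathscr A$ is nonempty and its top is not in $M$, move the top of $\mathscr A$ onto $\mathscr B$; then, if $\mathscr A$ is nonempty, move its top onto $\mathscr B$. The word $\theta'(\pi)$ is $\mathscr B$ read from top to bottom. An arbitrary $\pi\in\mathrm{Av}(231)$ is in exactly one way a direct sum $\pi=\pi^{(1)}\oplus\dots\oplus\pi^{(s)}$ of $231$-avoiding permutations each of which begins with its largest letter, where $(\alpha\oplus\beta)_i=\alpha_i$ for $i\le|\alpha|$ and $(\alpha\oplus\beta)_i=\beta_{i-|\alpha|}+|\alpha|$ for $i>|\alpha|$; put $\theta(\pi)=\theta'(\pi^{(1)})\oplus\dots\oplus\theta'(\pi^{(s)})$. Theorem. The composition $\Theta=c\circ r\circ\theta\circ c\circ r$ is a bijection from $\mathrm{Av}(312)$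 onto itself which maps $S_n(312)$ onto itself for every $n\ge1$, and $\mathrm{bast}(\pi)=\mathrm{foze}(\Theta(\pi))$ for every $\pi\in\mathrm{Av}(312)$. Consequently $\mathrm{bast}$ and $\mathrm{foze}$ are equidistributed on $\mathrm{Av}(312)$: for every $n\ge1$, $$\sum_{\pi\in S_n(312)}q^{\mathrm{bast}(\pi)}=\sum_{\pi\in S_n(312)}q^{\mathrm{foze}(\pi)}.$$ -/

import Mathlib

namespace PermStat

/-! Permutations are words: an `n`-permutation is a list containing each of `1, …, n` exactly once. -/

/-- `S_n`, the set of all permutations of length `n`, as words in the letters `1, …, n`. -/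
def permWords (n : ℕ) : Finset (List ℕ) :=
  (List.range' 1 n).permutations.toFinset

theorem mem_permWords {n : ℕ} {w : List ℕ} :
    w ∈ permWords n ↔ w.Perm (List.range' 1 n) := by
  simp [permWords]

/-- The occurrences in `w` of the vincular pattern with underlying word `σ`, where `j ∈ adj` means
that the `j`-th and `(j+1)`-st letters of the pattern (counted from `1`) are underlined together,
that is, have to be matched by neighbouring positions of `w`. An occurrence is an increasing choice
of positions of `w` whose letters are in the same relative order as those of `σ`.
Classical patterns have `adj = ∅`. -/
def occurrences (σ : List ℕ) (adj : Finset ℕ) (w : List ℕ) :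
    Finset (Fin σ.length → Fin w.length) :=
  Finset.univ.filter fun f =>
    (∀ a b : Fin σ.length, a < b → f a < f b) ∧
    (∀ a b : Fin σ.length, w.get (f a) < w.get (f b) ↔ σ.get a < σ.get b) ∧
    (∀ a b : Fin σ.length, (a : ℕ) + 1 ∈ adj → (b : ℕ) = a + 1 → (f b : ℕ) = f a + 1)

/-- The number of occurrences of a vincular pattern. -/
def occ (σ : List ℕ) (adj : Finset ℕ) (w : List ℕ) : ℕ :=
  (occurrences σ adj w).card

/-- `w` avoids the classical pattern `σ`. -/
def Avoids (σ w : List ℕ) : Prop :=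
  occurrences σ ∅ w = ∅

instance (σ w : List ℕ) : Decidable (Avoids σ w) :=
  inferInstanceAs (Decidable (_ = _))

/-- `S_n(σ)`, the set of `σ`-avoiding `n`-permutations. -/
def avoidersOfLength (n : ℕ) (σ : List ℕ) : Finset (List ℕ) :=
  (permWords n).filter (Avoids σ)

/-- `Av(σ)`, the set of all `σ`-avoiding permutations (of any length `n ≥ 1`). -/
def Av (σ : List ℕ) : Set (List ℕ) :=
  {w | ∃ n : ℕ, 1 ≤ n ∧ w ∈ avoidersOfLength n σ}

/-- The statistic `bast`: occurrences of `132` with `13` underlined, of `213` with `21` underlined,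
of `321` with `32` underlined, and of `21` underlined. -/
def bast (w : List ℕ) : ℕ :=
  occ [1, 3, 2] {1} w + occ [2, 1, 3] {1} w + occ [3, 2, 1] {1} w + occ [2, 1] {1} w

/-- The statistic `foze`: occurrences of `213` with `21` underlined, of `321` with `21` underlined,
of `132` with `13` underlined, and of `21` underlined. -/
def foze (w : List ℕ) : ℕ :=
  occ [2, 1, 3] {1} w + occ [3, 2, 1] {2} w + occ [1, 3, 2] {1} w + occ [2, 1] {1} w

/-- The reverse `π_n … π_1`. -/
def reversal (w : List ℕ) : List ℕ := w.reverse

/-- The complement `(n + 1 - π_1) … (n + 1 - π_n)`. -/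
def complement (w : List ℕ) : List ℕ := w.map fun x => w.length + 1 - x

/-- The inverse permutation: its `v`-th letter is the position (counted from `1`) of `v` in `w`. -/
def inverse (w : List ℕ) : List ℕ :=
  (List.range' 1 w.length).map fun v => w.idxOf v + 1

/-- The set of ascents `{i < n | π_i < π_{i+1}}`, positions being counted from `1`. -/
def Asc (w : List ℕ) : Finset ℕ :=
  (Finset.Ico 1 w.length).filter fun i => w.getD (i - 1) 0 < w.getD i 0

/-- The inverse descent runs of `w`, each given by the list of its elements (positions of `w`).
Cutting the word `w⁻¹` into its maximal decreasing factors, each factor lists the positions in `w`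
of the letters that form the corresponding descent run of `w⁻¹`.
The runs are arranged by decreasing maximum element. -/
def inverseDescentRuns (w : List ℕ) : List (List ℕ) :=
  ((inverse w).splitBy fun a b => decide (b < a)).insertionSort
    fun A B => B.foldr max 0 ≤ A.foldr max 0

/-- The first step of the construction: a permutation is sent to the pair of sequences `(c, m)`,
where `c` lists the sizes of the inverse descent runs, `m_1` is the length, and
`m_2 > m_3 > …` are the ascents. -/
def thetaPrimeOne (w : List ℕ) : List ℕ × List ℕ :=
  ((inverseDescentRuns w).map List.length, w.length :: (Asc w).sort (· ≥ ·))

/-- Push `p, p - 1, …` (`c` letters in all) onto the stack `A`, whose top is its head;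
return the next value of `p` and the new stack. -/
def pushRun : ℕ → ℕ → List ℕ → ℕ × List ℕ
  | 0, p, A => (p, A)
  | c + 1, p, A => pushRun c (p - 1) (p :: A)

/-- While the stack `A` is nonempty and its top is not in `M`, move the top of `A` onto `B`. -/
def transferWhile (M : List ℕ) : List ℕ → List ℕ → List ℕ × List ℕ
  | [], B => ([], B)
  | a :: A, B => if a ∉ M then transferWhile M A (a :: B) else (a :: A, B)

/-- If the stack `A` is nonempty, move its top onto `B`. -/
def transferOne : List ℕ → List ℕ → List ℕ × List ℕ
  | [], B => ([], B)
  | a :: A, B => (A, a :: B)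

/-- The two-stack algorithm with ascent tops `M`: run through the sequence `c`, starting from the
next letter `p` and the stacks `A` and `B`, and return the final stack `B`, read from its top. -/
def runStacks (M : List ℕ) : List ℕ → ℕ → List ℕ → List ℕ → List ℕ
  | [], _, _, B => B
  | c :: cs, p, A, B =>
    let pushed := pushRun c p A
    let s := transferWhile M pushed.2 B
    let t := transferOne s.1 s.2
    runStacks M cs pushed.1 t.1 t.2

/-- The second step of the construction: the pair `(c, m)` is turned into a permutation by the
two-stack algorithm, with first letter `m_1` to be pushed and ascent tops `m_2, m_3, …`. -/
def thetaPrimeTwo (cm : List ℕ × List ℕ) : List ℕ :=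
  runStacks cm.2.tail cm.1 (cm.2.headD 0) [] []

/-- The map `θ'` on `231`-avoiding permutations that begin with their largest letter. -/
def thetaPrime (w : List ℕ) : List ℕ := thetaPrimeTwo (thetaPrimeOne w)

/-- The direct sum `α ⊕ β`. -/
def directSum (α β : List ℕ) : List ℕ := α ++ β.map (· + α.length)

/-- The components of a permutation as a direct sum of permutations that begin with their largest
letter: if the first letter is `a`, then the first component consists of the first `a` letters.
By `components_eq` this finds the decomposition whenever there is one (every `231`-avoiding
permutation has one). -/
def components : List ℕ → List (List ℕ)
  | [] => []
  | a :: l => (a :: l.take (a - 1)) :: components ((l.drop (a - 1)).map (· - a))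
termination_by w => w.length
decreasing_by
  simp only [List.length_map, List.length_drop, List.length_cons]
  omega

/-- There is at most one way to write a word as a direct sum of words each of which begins with
its own length, and `components` finds it. -/
theorem components_eq (L : List (List ℕ))
    (hL : ∀ α ∈ L, α ≠ [] ∧ α.head? = some α.length) :
    components (L.foldr directSum []) = L := by
  induction L with
  | nil => simp [components]
  | cons α L ih =>
    obtain ⟨-, h2⟩ := hL α (by simp)
    have ih2 := ih fun β hβ => hL β (by simp [hβ])
    cases α with
    | nil => simp at h2
    | cons a l =>
      simp only [List.head?_cons, List.length_cons, Option.some.injEq] at h2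
      subst h2
      simp only [List.foldr_cons, directSum, List.cons_append, List.length_cons, components,
        Nat.add_sub_cancel]
      simp [Function.comp_def, ih2]

/-- `θ(π) = θ'(π⁽¹⁾) ⊕ ⋯ ⊕ θ'(π⁽ᵗ⁾)` for `π = π⁽¹⁾ ⊕ ⋯ ⊕ π⁽ᵗ⁾`. -/
def theta (w : List ℕ) : List ℕ :=
  ((components w).map thetaPrime).foldr directSum []

/-- `Θ = c ∘ r ∘ θ ∘ c ∘ r`. -/
def bigTheta : List ℕ → List ℕ :=
  complement ∘ reversal ∘ theta ∘ complement ∘ reversal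

end PermStat

namespace PermStat

/-! The reverse complement exchanges `312` and `231`, so everything reduces to what `θ` does on
`231`-avoiding permutations. Call a letter a rise if it is not a descent top; the last letter is
always a rise. In a `231`-avoiding permutation a rise is smaller than every later letter, and the
set of rises together with the set of their positions determines the permutation
(`Avoids231.eq_of_rises_eq`).

The heart of the proof is `IsRiseTransfer`: `θ(u)` has the same rises as `u`, and its letters that
are not descent bottoms are exactly the positions of the rises of `u`. Hence `u` can be recovered
from `θ(u)`, and an injection of a finite set into itself is a bijection. For one component this
comes from `runStacks_spec`. Each stage of the algorithm prepends to `B` a decreasing block; its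
last letter is the newest letter pushed and becomes a rise, and its first letter lies in the ascent
set, or is `n` at the last stage. The newest letters are the rises of the input because its inverse
descent runs are intervals of letters starting at the rises (`Avoids231.exists_inverseDescentRuns`).
That an ascent is available at every stage but the last is the counting lemma `countP_mem_Asc_lt`.
Direct sums respect all these data.

For the statistics, let `i` run over descents. On `312`-avoiders the terms of `bast` other than
`132` add up to a sum of distances of descents from the end (`bast_eq`), and those of `foze` to a
sum of complements of descent tops (`foze_eq`). After reverse complement these are the sum of
descent positions of `u` and the sum of descent bottoms of `θ(u)`; each complements, within `1 + ⋯ +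
n`, one of the two sums that `θ` equates. The common `132` term depends only on the number of
descents and the first letter (`occ_132_add`), that is, on the number of rises and the largest rise
of the reverse complement, and `θ` preserves both. -/

/-! ### Words avoiding `231`, recursively -/

/-- Recursive form of the avoidance of the classical pattern `231`. -/
def Avoids231 : List ℕ → Prop
  | [] => True
  | a :: l => l.Pairwise (fun b c => ¬ (c < a ∧ a < b)) ∧ Avoids231 l

theorem avoids231_iff_sublist {w : List ℕ} :
    Avoids231 w ↔ ∀ a b c, [a, b, c].Sublist w → ¬ (c < a ∧ a < b) := by
  induction w with
  | nil => simp [Avoids231]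
  | cons x l ih =>
    rw [Avoids231, ih, List.pairwise_iff_forall_sublist]
    constructor
    · rintro ⟨h1, h2⟩ a b c h
      rcases List.sublist_cons_iff.1 h with h | ⟨r, hr, h⟩
      · exact h2 a b c h
      · simp only [List.cons.injEq] at hr
        obtain ⟨rfl, rfl⟩ := hr
        exact h1 h
    · intro h
      exact ⟨fun {b c} hbc => h x b c (hbc.cons_cons x), fun a b c habc => h a b c (habc.cons x)⟩

theorem Avoids231.sublist {u w : List ℕ} (h : Avoids231 w) (hu : u.Sublist w) : Avoids231 u :=
  avoids231_iff_sublist.2 fun a b c habc => avoids231_iff_sublist.1 h a b c (habc.trans hu)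

theorem Avoids231.map_of_lt_imp_lt {w : List ℕ} {f : ℕ → ℕ}
    (hf : ∀ x ∈ w, ∀ y ∈ w, f x < f y → x < y) (h : Avoids231 w) : Avoids231 (w.map f) := by
  induction w with
  | nil => simp [Avoids231]
  | cons x l ih =>
    obtain ⟨h1, h2⟩ := h
    refine ⟨?_, ih (fun a ha b hb => hf a (by simp [ha]) b (by simp [hb])) h2⟩
    rw [List.pairwise_map]
    refine h1.imp_of_mem fun {b c} hb hc hbc hh => hbc ⟨?_, ?_⟩
    · exact hf _ (by simp [hc]) _ (by simp) hh.1
    · exact hf _ (by simp) _ (by simp [hb]) hh.2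

theorem Avoids231.append {u v : List ℕ} (hu : Avoids231 u) (hv : Avoids231 v)
    (huv : ∀ a ∈ u, ∀ b ∈ v, a < b) : Avoids231 (u ++ v) := by
  induction u with
  | nil => exact hv
  | cons x l ih =>
    refine ⟨?_, ih hu.2 fun a ha => huv a (by simp [ha])⟩
    refine List.pairwise_append.2 ⟨hu.1, ?_, ?_⟩
    · refine List.pairwise_of_forall_mem_list fun b _ c hc => ?_
      have := huv x (by simp) c hc
      omega
    · intro b _ c hc
      have := huv x (by simp) c hc
      omega

/-! ### Rises: letters that are not followed by a smaller letter -/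

/-- The letter `a`, followed by the word `v`, is not a descent top. -/
def IsRise (a : ℕ) (v : List ℕ) : Prop := ∀ b ∈ v.head?, a < b

instance (a : ℕ) (v : List ℕ) : Decidable (IsRise a v) := by
  unfold IsRise; infer_instance

@[simp] theorem isRise_nil (a : ℕ) : IsRise a [] := by simp [IsRise]

@[simp] theorem isRise_cons (a b : ℕ) (v : List ℕ) : IsRise a (b :: v) ↔ a < b := by simp [IsRise]

/-- The letters of a word that are not descent tops. -/
def riseLetters : List ℕ → List ℕ
  | [] => []
  | a :: v => if IsRise a v then a :: riseLetters v else riseLetters v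

/-- The positions of the letters that are not descent tops, the first position being `i`. -/
def risePositions : ℕ → List ℕ → List ℕ
  | _, [] => []
  | i, a :: v => if IsRise a v then i :: risePositions (i + 1) v else risePositions (i + 1) v

/-- The letters of a word that are not descent bottoms, where the word is preceded by `p`. -/
def nonBottoms : ℕ → List ℕ → List ℕ
  | _, [] => []
  | p, a :: v => if p < a then a :: nonBottoms a v else nonBottoms a v

theorem riseLetters_sublist (w : List ℕ) : (riseLetters w).Sublist w := by
  induction w with
  | nil => simp [riseLetters]
  | cons a v ih =>
    rw [riseLetters]
    split_ifs
    · exact ih.cons_cons a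
    · exact ih.cons a

theorem length_risePositions (i : ℕ) (w : List ℕ) :
    (risePositions i w).length = (riseLetters w).length := by
  induction w generalizing i with
  | nil => simp [risePositions, riseLetters]
  | cons a v ih => rw [risePositions, riseLetters]; split_ifs <;> simp [ih]

theorem risePositions_bounds {i j : ℕ} {w : List ℕ} (h : j ∈ risePositions i w) :
    i ≤ j ∧ j < i + w.length := by
  induction w generalizing i with
  | nil => simp [risePositions] at h
  | cons a v ih =>
    rw [risePositions] at h
    simp only [List.length_cons]
    split_ifs at h
    · rcases List.mem_cons.1 h with rfl | h
      · omega
      · have := ih h; omega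
    · have := ih h; omega

theorem risePositions_pairwise (i : ℕ) (w : List ℕ) : (risePositions i w).Pairwise (· < ·) := by
  induction w generalizing i with
  | nil => simp [risePositions]
  | cons a v ih =>
    rw [risePositions]
    split_ifs
    · refine List.pairwise_cons.2 ⟨fun j hj => ?_, ih _⟩
      have := risePositions_bounds hj
      omega
    · exact ih _

theorem getLast?_riseLetters (w : List ℕ) : (riseLetters w).getLast? = w.getLast? := by
  induction w with
  | nil => simp [riseLetters]
  | cons a v ih =>
    rw [riseLetters]
    cases v with
    | nil => simp [riseLetters]
    | cons b v =>
      split_ifs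
      · rw [List.getLast?_cons, ih]; simp [List.getLast?_cons]
      · rw [ih]; simp [List.getLast?_cons]

theorem mem_riseLetters_append_cons {u v : List ℕ} {y : ℕ} (h : (u ++ y :: v).Nodup) :
    y ∈ riseLetters (u ++ y :: v) ↔ IsRise y v := by
  induction u with
  | nil =>
    have : y ∉ riseLetters v := fun hy => by
      have := (riseLetters_sublist v).subset hy
      simp_all
    simp only [List.nil_append, riseLetters]
    split_ifs with h1 <;> simp [h1, this]
  | cons a u ih =>
    simp only [List.cons_append, List.nodup_cons] at h
    have hne : y ≠ a := fun e => h.1 (by simp [e])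
    simp only [List.cons_append, riseLetters]
    split_ifs
    · simp [hne, ih h.2]
    · exact ih h.2

theorem mem_risePositions_append_cons (i : ℕ) (u v : List ℕ) (y : ℕ) :
    i + u.length ∈ risePositions i (u ++ y :: v) ↔ IsRise y v := by
  induction u generalizing i with
  | nil =>
    have : i ∉ risePositions (i + 1) v := fun hi => by
      have := risePositions_bounds hi
      omega
    simp only [List.nil_append, risePositions]
    split_ifs with h1 <;> simp [h1, this]
  | cons a u ih =>
    have := ih (i + 1)
    rw [show i + 1 + u.length = i + (a :: u).length by simp; omega] at this
    simp only [List.cons_append, risePositions]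
    split_ifs
    · rw [← this]; simp
    · exact this

/-- The letter after `a` is larger, so a later letter below `a` would complete a `231`. -/
theorem Avoids231.lt_of_isRise {a : ℕ} {v : List ℕ} (h : Avoids231 (a :: v)) (hn : (a :: v).Nodup)
    (ha : IsRise a v) : ∀ c ∈ v, a < c := by
  cases v with
  | nil => simp
  | cons b v =>
    simp only [isRise_cons] at ha
    simp only [List.nodup_cons, List.mem_cons, not_or] at hn
    intro c hc
    rcases List.mem_cons.1 hc with rfl | hc
    · exact ha
    · have h1 := (List.pairwise_cons.1 h.1).1 c hc
      have : c ≠ a := fun e => hn.1.2 (e ▸ hc)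
      omega

theorem Avoids231.lt_of_mem_riseLetters {u v : List ℕ} {y : ℕ} (h : Avoids231 (u ++ y :: v))
    (hn : (u ++ y :: v).Nodup) (hy : y ∈ riseLetters (u ++ y :: v)) : ∀ c ∈ v, y < c :=
  (h.sublist (List.sublist_append_right _ _)).lt_of_isRise
    (hn.sublist (List.sublist_append_right _ _)) ((mem_riseLetters_append_cons hn).1 hy)

theorem Avoids231.riseLetters_pairwise {w : List ℕ} (h : Avoids231 w) (hn : w.Nodup) :
    (riseLetters w).Pairwise (· < ·) := by
  induction w with
  | nil => simp [riseLetters]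
  | cons a v ih =>
    rw [riseLetters]
    split_ifs with ha
    · exact List.pairwise_cons.2 ⟨fun c hc =>
        h.lt_of_isRise hn ha c ((riseLetters_sublist v).subset hc), ih h.2 hn.of_cons⟩
    · exact ih h.2 hn.of_cons

/-- In a permutation avoiding `231`, a letter `y` is not a descent top exactly if
the letter `y - 1` does not occur after it. -/
theorem Avoids231.isRise_iff {n : ℕ} {u v : List ℕ} {y : ℕ} (h : Avoids231 (u ++ y :: v))
    (hp : (u ++ y :: v).Perm (List.range' 1 n)) :
    IsRise y v ↔ y = 1 ∨ y - 1 ∈ u := by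
  have hn : (u ++ y :: v).Nodup := hp.nodup_iff.2 (List.nodup_range' ..)
  have hmem : ∀ x, x ∈ u ++ y :: v ↔ 1 ≤ x ∧ x ≤ n := fun x => by
    rw [hp.mem_iff, List.mem_range'_1]; omega
  have hy := (hmem y).1 (by simp)
  constructor
  · intro hr
    have hlt := (h.sublist (List.sublist_append_right _ _)).lt_of_isRise
      (hn.sublist (List.sublist_append_right _ _)) hr
    by_cases h1 : y = 1
    · exact Or.inl h1
    · have := (hmem (y - 1)).2 (by omega)
      simp only [List.mem_append, List.mem_cons] at this
      rcases this with h | h | h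
      · exact Or.inr h
      · omega
      · have := hlt _ h; omega
  · intro hr
    cases v with
    | nil => simp
    | cons b v =>
      rw [isRise_cons]
      have hb := (hmem b).1 (by simp)
      have hn2 := List.nodup_append.1 hn
      have hby : y ≠ b := fun e => by
        have := hn2.2.1
        simp [e] at this
      rcases hr with h1 | h1
      · omega
      · have hne : y - 1 ≠ b := hn2.2.2 _ h1 b (by simp)
        have hs : [y - 1, y, b].Sublist (u ++ y :: b :: v) :=
          (List.singleton_sublist.2 h1).append
            (((List.nil_sublist v).cons_cons b).cons_cons y)
        have := avoids231_iff_sublist.1 h _ _ _ hs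
        have := hmem (y - 1) |>.1 (by simp [h1])
        omega

/-! ### A `231`-avoiding permutation is determined by its rises -/

/-- Suppose `a < a'`. If both are rises, then `a'` is also a rise of `w` and stands there before the
smaller letter `a`, which is impossible. If neither is, `a` stands before `a'` in `w'`, and `a`,
`a'` and the head of `t` form a `231`. -/
theorem Avoids231.not_lt_of_append_cons {n : ℕ} {w w' u u' t : List ℕ} {a a' : ℕ}
    (hw : Avoids231 w) (hw' : Avoids231 w')
    (hp : w.Perm (List.range' 1 n)) (hp' : w'.Perm (List.range' 1 n))
    (hl : riseLetters w = riseLetters w') (e : w = u ++ a :: t) (e' : w' = u' ++ a' :: t)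
    (hr : IsRise a t ↔ IsRise a' t) : ¬ a < a' := by
  intro hlt
  have hn : w.Nodup := hp.nodup_iff.2 (List.nodup_range' ..)
  have hn' : w'.Nodup := hp'.nodup_iff.2 (List.nodup_range' ..)
  have hpp := hp.trans hp'.symm
  by_cases h : IsRise a t
  · have h' := hr.1 h
    have h1 : a' ∈ riseLetters w := by
      rw [hl, e', mem_riseLetters_append_cons (e' ▸ hn')]; exact h'
    have h2 : a' ∈ u := by
      have h3 : a' ∈ u ++ a :: t := e ▸ (riseLetters_sublist w).subset h1
      have h4 : a' ∉ t := by
        have := (List.nodup_append.1 (e' ▸ hn')).2.1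
        simp_all
      simp only [List.mem_append, List.mem_cons, h4, or_false] at h3
      exact h3.resolve_right (by omega)
    obtain ⟨s, r, rfl⟩ := List.append_of_mem h2
    simp only [List.append_assoc, List.cons_append] at e
    subst e
    have := hw.lt_of_mem_riseLetters hn h1 a (by simp)
    omega
  · cases t with
    | nil => simp at h
    | cons b t =>
      rw [isRise_cons] at h
      have hab : a ≠ b := fun e1 => by
        have := (List.nodup_append.1 (e ▸ hn)).2.1
        simp [e1] at this
      have h4 : a ∉ b :: t := by
        have := (List.nodup_append.1 (e ▸ hn)).2.1
        simp_all
      have h2 : a ∈ u' := by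
        have h3 : a ∈ u' ++ a' :: b :: t := by rw [← e', ← hpp.mem_iff, e]; simp
        simp only [List.mem_append, List.mem_cons (b := a'), h4, or_false] at h3
        exact h3.resolve_right (by omega)
      have hs : [a, a', b].Sublist (u' ++ a' :: b :: t) :=
          (List.singleton_sublist.2 h2).append
            (((List.nil_sublist t).cons_cons b).cons_cons a')
      have := avoids231_iff_sublist.1 (e' ▸ hw') _ _ _ hs
      omega

/-- The word is reconstructed from right to left: with a common suffix known, the positions tell
whether the next letter is a rise, and `Avoids231.not_lt_of_append_cons` applied both ways forces
that letter. -/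
theorem Avoids231.eq_of_rises_eq {n : ℕ} {w w' : List ℕ}
    (hw : Avoids231 w) (hw' : Avoids231 w')
    (hp : w.Perm (List.range' 1 n)) (hp' : w'.Perm (List.range' 1 n))
    (hl : riseLetters w = riseLetters w') (hi : risePositions 1 w = risePositions 1 w') :
    w = w' := by
  have hlen : w.length = w'.length := (hp.trans hp'.symm).length_eq
  have key : ∀ v u v' u', w = u ++ v → w' = u' ++ v' → v.length = v'.length → v = v' := by
    intro v
    induction v with
    | nil => intro u v' u' _ _ h; simpa [eq_comm] using h
    | cons a t ih =>
      intro u v' u' e e' h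
      cases v' with
      | nil => simp at h
      | cons a' t' =>
        have ht : t = t' := ih (u ++ [a]) t' (u' ++ [a']) (by simp [e]) (by simp [e'])
          (by simpa using h)
        subst ht
        have hu : u.length = u'.length := by
          rw [e, e'] at hlen
          simpa using hlen
        have hr : IsRise a t ↔ IsRise a' t := by
          rw [← mem_risePositions_append_cons 1 u, ← e, hi, e', hu,
            mem_risePositions_append_cons]
        have h1 := hw.not_lt_of_append_cons hw' hp hp' hl e e' hr
        have h2 := hw'.not_lt_of_append_cons hw hp' hp hl.symm e' e hr.symm
        rw [show a = a' by omega]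
  exact key w [] w' [] rfl rfl hlen

/-! ### Behaviour under direct sums -/

theorem risePositions_append {i : ℕ} {u v : List ℕ}
    (huv : ∀ a ∈ u.getLast?, ∀ b ∈ v.head?, a < b) :
    risePositions i (u ++ v) = risePositions i u ++ risePositions (i + u.length) v := by
  induction u generalizing i with
  | nil => simp [risePositions]
  | cons a u ih =>
    have h : IsRise a (u ++ v) ↔ IsRise a u := by
      cases u with
      | cons b u => simp
      | nil =>
        cases v with
        | nil => simp
        | cons c v => simpa using huv
    have ih := ih (i := i + 1) fun x hx => huv x (by
      rw [List.getLast?_cons, Option.mem_def.1 hx]; rfl)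
    rw [show i + 1 + u.length = i + (a :: u).length by simp; omega] at ih
    simp only [List.cons_append, risePositions, h, ih]
    split_ifs <;> rfl

theorem riseLetters_append {u v : List ℕ}
    (huv : ∀ a ∈ u.getLast?, ∀ b ∈ v.head?, a < b) :
    riseLetters (u ++ v) = riseLetters u ++ riseLetters v := by
  induction u with
  | nil => simp [riseLetters]
  | cons a u ih =>
    have h : IsRise a (u ++ v) ↔ IsRise a u := by
      cases u with
      | cons b u => simp
      | nil =>
        cases v with
        | nil => simp
        | cons c v => simpa using huv
    have ih := ih fun x hx => huv x (by
      rw [List.getLast?_cons, Option.mem_def.1 hx]; rfl)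
    simp only [List.cons_append, riseLetters, h, ih]
    split_ifs <;> rfl

/-- The first letter of `v` is preceded by a smaller letter in the concatenation, so any lower bound
`q` can stand in for its predecessor. -/
theorem nonBottoms_append {p q : ℕ} {u v : List ℕ} (hp : ∀ b ∈ v, p < b) (hq : ∀ b ∈ v, q < b)
    (huv : ∀ a ∈ u, ∀ b ∈ v, a < b) :
    nonBottoms p (u ++ v) = nonBottoms p u ++ nonBottoms q v := by
  induction u generalizing p with
  | nil =>
    cases v with
    | nil => simp [nonBottoms]
    | cons c v => simp [nonBottoms, hp c (by simp), hq c (by simp)]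
  | cons a u ih =>
    have ih := ih (p := a) (huv a (by simp)) fun x hx => huv x (by simp [hx])
    simp only [List.cons_append, nonBottoms, ih]
    split_ifs <;> rfl

theorem isRise_map_add (k a : ℕ) (v : List ℕ) : IsRise (a + k) (v.map (· + k)) ↔ IsRise a v := by
  cases v <;> simp

theorem riseLetters_map_add (k : ℕ) (w : List ℕ) :
    riseLetters (w.map (· + k)) = (riseLetters w).map (· + k) := by
  induction w with
  | nil => simp [riseLetters]
  | cons a v ih =>
    simp only [List.map_cons, riseLetters, isRise_map_add, ih]
    split_ifs <;> simp

theorem risePositions_map_add (i j k : ℕ) (w : List ℕ) :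
    risePositions (i + j) (w.map (· + k)) = (risePositions i w).map (· + j) := by
  induction w generalizing i with
  | nil => simp [risePositions]
  | cons a v ih =>
    have ih := ih (i + 1)
    rw [show i + 1 + j = i + j + 1 by omega] at ih
    simp only [List.map_cons, risePositions, isRise_map_add, ih]
    split_ifs <;> simp

theorem nonBottoms_map_add (p k : ℕ) (w : List ℕ) :
    nonBottoms (p + k) (w.map (· + k)) = (nonBottoms p w).map (· + k) := by
  induction w generalizing p with
  | nil => simp [nonBottoms]
  | cons a v ih =>
    simp only [List.map_cons, nonBottoms, ih, add_lt_add_iff_right]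
    split_ifs <;> simp

/-! ### Inverse descent runs -/

/-- The first elements of consecutive intervals of lengths `c₁, c₂, …`, the first starting at `a`. -/
def intervalStarts : ℕ → List ℕ → List ℕ
  | _, [] => []
  | a, c :: cs => a :: intervalStarts (a + c) cs

theorem length_intervalStarts (a : ℕ) (cs : List ℕ) :
    (intervalStarts a cs).length = cs.length := by
  induction cs generalizing a with
  | nil => rfl
  | cons c cs ih => simp [intervalStarts, ih]

theorem intervalStarts_append (a : ℕ) (cs ds : List ℕ) :
    intervalStarts a (cs ++ ds) = intervalStarts a cs ++ intervalStarts (a + cs.sum) ds := by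
  induction cs generalizing a with
  | nil => simp [intervalStarts]
  | cons c cs ih => simp [intervalStarts, ih, add_assoc]

theorem foldr_max_eq_head {a : ℕ} {l : List ℕ} (h : (a :: l).IsChain (fun x y => y < x)) :
    (a :: l).foldr max 0 = a := by
  induction l generalizing a with
  | nil => simp
  | cons b l ih =>
    rw [List.isChain_cons_cons] at h
    rw [List.foldr_cons, ih h.2]
    exact max_eq_left h.1.le

theorem filter_range'_of_antitone {f : ℕ → ℕ} {a m : ℕ}
    (h : ((List.range' a (m + 1)).map f).IsChain (fun x y => y < x)) :
    (List.range' a (m + 1)).filter (fun v => v = a ∨ ¬ f v < f (v - 1)) = [a] := by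
  rw [List.range'_succ, List.filter_cons_of_pos (by simp), List.cons.injEq]
  refine ⟨rfl, ?_⟩
  rw [List.filter_eq_nil_iff]
  intro v hv
  rw [List.mem_range'_1] at hv
  rw [List.isChain_iff_getElem] at h
  have := h (v - 1 - a) (by simp; omega)
  simp only [List.getElem_map, List.getElem_range', one_mul] at this
  rw [show a + (v - 1 - a + 1) = v by omega, show a + (v - 1 - a) = v - 1 by omega] at this
  simp [this]
  omega

/-- Here `S` cuts the values of `f` on an interval into maximal decreasing factors. A factor begins
exactly where `f` fails to descend, and its maximum is its first value. -/
theorem intervalStarts_of_flatten_eq {f : ℕ → ℕ} {S : List (List ℕ)} {a N : ℕ}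
    (hflat : S.flatten = (List.range' a N).map f) (hne : [] ∉ S)
    (hchain : ∀ m ∈ S, m.IsChain (fun x y => y < x))
    (hbd : S.IsChain fun A B => ∃ (hA : A ≠ []) (hB : B ≠ []), ¬ B.head hB < A.getLast hA) :
    intervalStarts a (S.map List.length) =
        (List.range' a N).filter (fun v => v = a ∨ ¬ f v < f (v - 1)) ∧
      S.map (fun A => A.foldr max 0) = (intervalStarts a (S.map List.length)).map f := by
  induction S generalizing a N with
  | nil =>
    have : N = 0 := by simpa using congrArg List.length hflat.symm
    subst this
    simp [intervalStarts]
  | cons R S ih =>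
    rw [List.flatten_cons] at hflat
    have hlen : R.length ≤ N := by
      have := congrArg List.length hflat
      simp only [List.length_append, List.length_map, List.length_range'] at this
      omega
    obtain ⟨K, rfl⟩ := Nat.exists_eq_add_of_le hlen
    rw [← List.range'_append_1, List.map_append] at hflat
    obtain ⟨hR, hS⟩ := List.append_inj hflat (by simp)
    have hRne : R ≠ [] := fun e => hne (by simp [e])
    obtain ⟨ih1, ih2⟩ := ih hS (fun h => hne (by simp [h])) (fun m hm => hchain m (by simp [hm]))
      hbd.tail
    obtain ⟨m, hm⟩ : ∃ m, R.length = m + 1 := ⟨R.length - 1, by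
      have := List.length_pos_iff.2 hRne; omega⟩
    have hRc := hchain R (by simp)
    constructor
    · rw [List.map_cons, intervalStarts, ih1, ← List.range'_append_1, List.filter_append]
      have h1 := hRc
      rw [hR, hm] at h1
      rw [hm, filter_range'_of_antitone h1, List.singleton_append, List.cons.injEq]
      refine ⟨rfl, List.filter_congr fun v hv => ?_⟩
      rw [List.mem_range'_1] at hv
      simp only [decide_eq_decide]
      have : v ≠ a := by omega
      simp only [this, false_or, or_iff_right_iff_imp]
      rintro rfl
      cases S with
      | nil =>
        have : K = 0 := by simpa using congrArg List.length hS.symm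
        omega
      | cons T S =>
        obtain ⟨hA, hB, hlt⟩ := (List.isChain_cons_cons.1 hbd).1
        have hK : K = K - 1 + 1 := by omega
        have e1 : R.getLast hA = f (a + m) := by
          rw [List.getLast_eq_getElem]
          simp only [hm, Nat.add_sub_cancel]
          have : R[m]? = some (f (a + m)) := by
            rw [hR]; simp [hm]
          exact (List.getElem?_eq_some_iff.1 this).2
        have e2 : T.head hB = f (a + (m + 1)) := by
          have : (T :: S).flatten.head? = some (f (a + (m + 1))) := by
            rw [hS, hm, hK, List.range'_succ]; simp
          rw [List.flatten_cons, List.head?_append_of_ne_nil _ hB,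
            List.head?_eq_some_head hB] at this
          simpa using this
        rw [e1, e2] at hlt
        simpa [← add_assoc] using hlt
    · rw [List.map_cons, List.map_cons, intervalStarts, List.map_cons, ih2]
      congr 1
      rw [hm, List.range'_succ, List.map_cons] at hR
      rw [hR] at hRc ⊢
      exact foldr_max_eq_head hRc

theorem pairwise_idxOf {w : List ℕ} (hn : w.Nodup) :
    w.Pairwise (fun x y => w.idxOf x < w.idxOf y) := by
  rw [List.pairwise_iff_getElem]
  intro i j hi hj hij
  rwa [hn.idxOf_getElem, hn.idxOf_getElem]

/-- Both lists are strictly increasing, so only membership has to be compared; this is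
`Avoids231.isRise_iff` phrased through positions. -/
theorem Avoids231.riseLetters_eq_filter {n : ℕ} {w : List ℕ} (h : Avoids231 w)
    (hp : w.Perm (List.range' 1 n)) :
    riseLetters w = (List.range' 1 n).filter
      (fun v => v = 1 ∨ ¬ w.idxOf v + 1 < w.idxOf (v - 1) + 1) := by
  have hn : w.Nodup := hp.nodup_iff.2 (List.nodup_range' ..)
  have hsorted : ((List.range' 1 n).filter
      (fun v => v = 1 ∨ ¬ w.idxOf v + 1 < w.idxOf (v - 1) + 1)).Pairwise (· < ·) :=
    (List.pairwise_lt_range').filter _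
  refine List.Perm.eq_of_pairwise (le := (· < ·)) (fun a b _ _ h1 h2 => by omega)
    (h.riseLetters_pairwise hn) hsorted ?_
  rw [List.perm_ext_iff_of_nodup (hn.sublist (riseLetters_sublist w)) hsorted.nodup]
  intro v
  rw [List.mem_filter, ← hp.mem_iff, decide_eq_true_eq]
  by_cases hv : v ∈ w
  swap
  · simp only [hv, false_and, iff_false]
    exact fun h => hv ((riseLetters_sublist w).subset h)
  simp only [hv, true_and]
  have hv1 : 1 ≤ v := by
    have := hp.mem_iff.1 hv
    rw [List.mem_range'_1] at this
    exact this.1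
  obtain ⟨u, t, rfl⟩ := List.append_of_mem hv
  rw [mem_riseLetters_append_cons hn, h.isRise_iff hp]
  have hvu : v ∉ u := fun hvu => by
    have := (List.nodup_append.1 hn).2.2 v hvu v (by simp)
    exact this rfl
  have e1 : (u ++ v :: t).idxOf v = u.length := by
    rw [List.idxOf_append_of_notMem hvu]; simp
  by_cases h1 : v = 1
  · simp [h1]
  · simp only [h1, false_or, e1]
    constructor
    · intro hu
      have := List.idxOf_lt_length_of_mem hu
      rw [List.idxOf_append_of_mem hu]
      omega
    · intro hle
      by_contra hu
      rw [List.idxOf_append_of_notMem hu, List.idxOf_cons_ne _ (by omega)] at hle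
      omega

/-- The sizes of the inverse descent runs of a `231`-avoiding permutation, read backwards, are the
lengths of the intervals of letters that start at the letters which are not descent tops. -/
theorem Avoids231.exists_inverseDescentRuns {n : ℕ} {w : List ℕ} (h : Avoids231 w)
    (hp : w.Perm (List.range' 1 n)) :
    ∃ cs : List ℕ, (inverseDescentRuns w).map List.length = cs.reverse ∧
      intervalStarts 1 cs = riseLetters w ∧ (∀ c ∈ cs, 0 < c) ∧ cs.sum = n := by
  have hn : w.Nodup := hp.nodup_iff.2 (List.nodup_range' ..)
  have hlen : w.length = n := by simpa using hp.length_eq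
  set S := (inverse w).splitBy fun a b => decide (b < a) with hS
  obtain ⟨h1, h2, h3, h4⟩ := List.splitBy_eq_iff.1 hS.symm
  simp only [decide_eq_true_eq, decide_eq_false_iff_not] at h3 h4
  have hflat : S.flatten = (List.range' 1 n).map (fun v => w.idxOf v + 1) := by
    rw [← h1, inverse, hlen]
  obtain ⟨k1, k2⟩ := intervalStarts_of_flatten_eq hflat h2 h3 h4
  rw [← h.riseLetters_eq_filter hp] at k1
  refine ⟨S.map List.length, ?_, k1, ?_, ?_⟩
  · rw [← List.map_reverse, inverseDescentRuns]
    congr 1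
    -- The maximum of a run is the position of its smallest letter, which is a rise. Rises increase
    -- along the word, so sorting by decreasing maximum just reverses the list of runs.
    have hlt : S.Pairwise (fun A B => A.foldr max 0 < B.foldr max 0) := by
      rw [← List.pairwise_map (f := fun A : List ℕ => A.foldr max 0) (R := (· < ·)), k2, k1,
        List.pairwise_map]
      refine ((pairwise_idxOf hn).sublist (riseLetters_sublist w)).imp fun h => ?_
      omega
    -- The sorting relation is only a preorder on lists; distinct maxima make it antisymmetric on
    -- `S`, so the sorted list is unique.
    have hinj : ∀ A ∈ S, ∀ B ∈ S, A.foldr max 0 = B.foldr max 0 → A = B := by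
      have hnd : (S.map fun A => A.foldr max 0).Nodup :=
        (List.pairwise_map.2 hlt).imp (S := (· ≠ ·)) fun h => ne_of_lt h
      exact fun A hA B hB hAB => List.inj_on_of_nodup_map hnd hA hB hAB
    have : Std.Total (fun A B : List ℕ => B.foldr max 0 ≤ A.foldr max 0) :=
      ⟨fun A B => le_total _ _⟩
    have : IsTrans (List ℕ) (fun A B : List ℕ => B.foldr max 0 ≤ A.foldr max 0) :=
      ⟨fun A B C h1 h2 => le_trans h2 h1⟩
    refine List.Perm.eq_of_pairwise (le := fun A B : List ℕ => B.foldr max 0 ≤ A.foldr max 0)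
      ?_ (List.pairwise_insertionSort _ _) ?_ ?_
    · intro A B hA hB h1 h2
      rw [List.mem_insertionSort] at hA
      rw [List.mem_reverse] at hB
      exact hinj A hA B hB (le_antisymm h2 h1)
    · rw [List.pairwise_reverse]
      exact hlt.imp fun h => h.le
    · exact (List.perm_insertionSort _ _).trans (List.reverse_perm _).symm
  · intro c hc
    obtain ⟨A, hA, rfl⟩ := List.mem_map.1 hc
    exact List.length_pos_iff.2 fun e => h2 (e ▸ hA)
  · rw [← List.length_flatten, hflat]
    simp

/-! ### The two-stack algorithm -/

theorem pushRun_eq (c p : ℕ) (A : List ℕ) (h : c ≤ p) :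
    pushRun c p A = (p - c, List.range' (p - c + 1) c ++ A) := by
  induction c generalizing p A with
  | zero => simp [pushRun]
  | succ c ih =>
    rw [pushRun, ih _ _ (by omega), List.range'_concat]
    simp only [Prod.mk.injEq, List.append_assoc, List.singleton_append, one_mul]
    refine ⟨by omega, ?_⟩
    rw [show p - (c + 1) + 1 = p - 1 - c + 1 by omega, show p - 1 - c + 1 + c = p by omega]

theorem transferWhile_append_cons {M P A B : List ℕ} {m : ℕ} (hP : ∀ x ∈ P, x ∉ M) (hm : m ∈ M) :
    transferWhile M (P ++ m :: A) B = (m :: A, P.reverse ++ B) := by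
  induction P generalizing B with
  | nil => simp [transferWhile, hm]
  | cons x P ih =>
    rw [List.cons_append, transferWhile, if_pos (hP x (by simp)),
      ih fun y hy => hP y (by simp [hy])]
    simp

theorem transferWhile_eq_nil {M A B : List ℕ} (hA : ∀ x ∈ A, x ∉ M) :
    transferWhile M A B = ([], A.reverse ++ B) := by
  induction A generalizing B with
  | nil => simp [transferWhile]
  | cons x P ih =>
    rw [transferWhile, if_pos (hA x (by simp)), ih fun y hy => hA y (by simp [hy])]
    simp

/-- Move one letter `x` at a time. The separation hypothesis for `x` says that it starts no `231` in
front of `B`. Since `x` is below every letter `a` left on the stack, it cannot be the larger letter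
of a pair that straddles `a`, so separation persists. -/
theorem Avoids231.reverse_append {Q A B : List ℕ} (h : (Q ++ A).Pairwise (· < ·))
    (hB : Avoids231 B) (hs : ∀ a ∈ Q ++ A, B.Pairwise (fun b c => ¬ (c < a ∧ a < b))) :
    Avoids231 (Q.reverse ++ B) ∧
      ∀ a ∈ A, (Q.reverse ++ B).Pairwise (fun b c => ¬ (c < a ∧ a < b)) := by
  induction Q generalizing B with
  | nil => exact ⟨hB, hs⟩
  | cons x Q ih =>
    rw [List.cons_append, List.pairwise_cons] at h
    rw [List.reverse_cons, List.append_assoc, List.singleton_append]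
    refine ih h.2 ⟨hs x (by simp), hB⟩ fun a ha => ?_
    refine List.pairwise_cons.2 ⟨fun c _ => ?_, hs a (by simp at ha ⊢; tauto)⟩
    have := h.1 a ha
    omega

theorem riseLetters_reverse_append {x : ℕ} {Q B : List ℕ} (h : (x :: Q).Pairwise (· < ·)) :
    riseLetters ((x :: Q).reverse ++ B) = riseLetters (x :: B) := by
  induction Q generalizing x B with
  | nil => simp
  | cons y Q ih =>
    have hxy : x < y := (List.pairwise_cons.1 h).1 y (by simp)
    rw [List.reverse_cons, List.append_assoc, List.singleton_append, ih h.of_cons]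
    rw [riseLetters, if_neg (by simp; omega)]

theorem nonBottoms_reverse_append {x : ℕ} {Q B : List ℕ} (hx : 0 < x)
    (h : (x :: Q).Pairwise (· < ·)) :
    nonBottoms 0 ((x :: Q).reverse ++ B) =
      (x :: Q).getLastD 0 :: nonBottoms x B := by
  induction Q generalizing x B with
  | nil => simp [nonBottoms, hx]
  | cons y Q ih =>
    have hxy : x < y := (List.pairwise_cons.1 h).1 y (by simp)
    rw [List.reverse_cons, List.append_assoc, List.singleton_append, ih (by omega) h.of_cons]
    rw [nonBottoms, if_neg (by omega)]
    simp

theorem nonBottoms_eq_of_forall_lt {p q : ℕ} {B : List ℕ} (hp : ∀ b ∈ B, p < b)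
    (hq : ∀ b ∈ B, q < b) : nonBottoms p B = nonBottoms q B := by
  simpa [nonBottoms] using
    nonBottoms_append (p := p) (q := q) (u := []) (v := B) hp hq (by simp)

/-- The output of the two-stack algorithm, provided that the letters of `M` allow
all the stages but the last one to end at a letter of `M`. -/
theorem runStacks_spec {M : List ℕ} {n : ℕ} (hnM : n ∉ M) (cs : List ℕ) (p : ℕ) (A B : List ℕ)
    (hne : cs ≠ []) (hpos : ∀ c ∈ cs, 0 < c) (hsum : cs.sum = p) (hpn : p ≤ n)
    (hA : A.Pairwise (· < ·)) (hAB : (A ++ B).Perm (List.range' (p + 1) (n - p)))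
    (hB : Avoids231 B) (hsep : ∀ a ∈ A, B.Pairwise (fun b c => ¬ (c < a ∧ a < b)))
    (hbot : nonBottoms 0 B = B.filter (· ∈ M)) (hn : p = n ∨ n ∈ A)
    (hcount : A.countP (· ∈ M) + (List.range' 1 p).countP (· ∈ M) + 1 = cs.length)
    (hvalid : ∀ s₁ s₂, cs = s₁ ++ s₂ → s₁ ≠ [] → s₂ ≠ [] →
      (List.range' 1 s₂.sum).countP (· ∈ M) < s₂.length) :
    (runStacks M cs p A B).Perm (List.range' 1 n) ∧ Avoids231 (runStacks M cs p A B) ∧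
      (runStacks M cs p A B).head? = some n ∧
      riseLetters (runStacks M cs p A B) = intervalStarts 1 cs.reverse ++ riseLetters B ∧
      nonBottoms 0 (runStacks M cs p A B) =
        (runStacks M cs p A B).filter (fun x => x = n ∨ x ∈ M) := by
  -- The invariants say that `A` increases from its top, that no letter of `A` would start a `231`
  -- in front of `B`, and that the letters of `M` not yet on `B` are one fewer than the stages left.
  induction cs generalizing p A B with
  | nil => exact absurd rfl hne
  | cons c cs ih =>
    have hc : 0 < c := hpos c (by simp)
    rw [List.sum_cons] at hsum
    obtain ⟨q, rfl⟩ : ∃ q, p = q + c := ⟨cs.sum, by omega⟩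
    have hq : cs.sum = q := by omega
    have hpush : pushRun c (q + c) A = (q, List.range' (q + 1) c ++ A) := by
      rw [pushRun_eq _ _ _ (by omega), Nat.add_sub_cancel]
    have hmemAB : ∀ x ∈ A ++ B, q + c < x ∧ x ≤ n := fun x hx => by
      rw [hAB.mem_iff, List.mem_range'_1] at hx
      omega
    obtain ⟨c', rfl⟩ : ∃ c', c = c' + 1 := ⟨c - 1, by omega⟩
    obtain ⟨A₁, hA₁⟩ : ∃ A₁, A₁ = List.range' (q + 1) (c' + 1) ++ A := ⟨_, rfl⟩
    have hhead : A₁ = (q + 1) :: (List.range' (q + 2) c' ++ A) := by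
      rw [hA₁, List.range'_succ]; rfl
    have hsortA₁ : A₁.Pairwise (· < ·) := by
      rw [hA₁, List.pairwise_append]
      refine ⟨List.pairwise_lt_range', hA, fun a ha b hb => ?_⟩
      rw [List.mem_range'_1] at ha
      have := hmemAB b (by simp [hb])
      omega
    have hperm₁ : (A₁ ++ B).Perm (List.range' (q + 1) (n - q)) := by
      rw [show n - q = (c' + 1) + (n - (q + (c' + 1))) by omega, ← List.range'_append_1, hA₁,
        List.append_assoc]
      refine List.Perm.append_left _ ?_
      rwa [show q + 1 + (c' + 1) = q + (c' + 1) + 1 by omega]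
    have hBlt : ∀ b ∈ B, q + 1 < b := fun b hb => by
      have := hmemAB b (by simp [hb]); omega
    have hsep₁ : ∀ a ∈ A₁, B.Pairwise (fun b c => ¬ (c < a ∧ a < b)) := by
      intro a ha
      rw [hA₁, List.mem_append, List.mem_range'_1] at ha
      rcases ha with ha | ha
      · refine List.pairwise_of_forall_mem_list fun b _ c hc => ?_
        have := hmemAB c (by simp [hc])
        omega
      · exact hsep a ha
    have hcount₁ : A₁.countP (· ∈ M) + (List.range' 1 q).countP (· ∈ M) + 1 = cs.length + 1 := by
      rw [← List.range'_append_1, List.countP_append, List.length_cons] at hcount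
      rw [hA₁, List.countP_append, ← hcount, Nat.add_comm 1 q]
      omega
    have hn₁ : n ∈ A₁ := by
      rw [hA₁, List.mem_append, List.mem_range'_1]
      rcases hn with hn | hn
      · left; omega
      · exact Or.inr hn
    have hnodup : (A₁ ++ B).Nodup := hperm₁.nodup_iff.2 (List.nodup_range' ..)
    have hnB : n ∉ B := fun h => (List.nodup_append.1 hnodup).2.2 n hn₁ n h rfl
    have hmem₁ : ∀ x ∈ A₁ ++ B, x ≤ n := fun x hx => by
      rw [hperm₁.mem_iff, List.mem_range'_1] at hx
      omega
    -- The moved block decreases down to the newest letter `q + 1`, and all of `B` lies above `q +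
    -- 1`; so the block contributes this single rise.
    have hrise : ∀ Q A', A₁ = ((q + 1) :: Q) ++ A' →
        riseLetters (((q + 1) :: Q).reverse ++ B) = (q + 1) :: riseLetters B := by
      intro Q A' e
      rw [e] at hsortA₁
      rw [riseLetters_reverse_append (List.pairwise_append.1 hsortA₁).1, riseLetters, if_pos]
      intro b hb
      exact hBlt b (List.mem_of_mem_head? hb)
    -- Only the first letter of the block is not a descent bottom. The old first letter of `B`
    -- remains a non-bottom, being preceded by the smaller letter `q + 1`.
    have hnb : ∀ Q A', A₁ = ((q + 1) :: Q) ++ A' →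
        nonBottoms 0 (((q + 1) :: Q).reverse ++ B) =
          ((q + 1) :: Q).getLastD 0 :: B.filter (· ∈ M) := by
      intro Q A' e
      rw [e] at hsortA₁
      rw [nonBottoms_reverse_append (by omega) (List.pairwise_append.1 hsortA₁).1,
        nonBottoms_eq_of_forall_lt (q := 0) hBlt (fun b hb => by have := hBlt b hb; omega), hbot]
    have hstarts : intervalStarts 1 ((c' + 1) :: cs).reverse =
        intervalStarts 1 cs.reverse ++ [q + 1] := by
      rw [List.reverse_cons, intervalStarts_append, List.sum_reverse, hq, Nat.add_comm 1 q]
      rfl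
    by_cases hcs : cs = []
    · subst hcs
      -- At the last stage the count leaves no letter of `M`, so the whole stack is emptied and its
      -- bottom `n` becomes the first letter.
      have hAM : ∀ x ∈ A₁, x ∉ M := by
        have : A₁.countP (· ∈ M) = 0 := by
          simp only [List.length_nil] at hcount₁; omega
        simpa [List.countP_eq_zero] using this
      have hrun : runStacks M [c' + 1] (q + (c' + 1)) A B = A₁.reverse ++ B := by
        simp [runStacks, hpush, ← hA₁, transferWhile_eq_nil hAM, transferOne]
      have hq0 : q = 0 := by simpa using hq.symm
      obtain ⟨L, hL⟩ : ∃ L, A₁ = L ++ [n] := by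
        obtain ⟨L, R, hLR⟩ := List.append_of_mem hn₁
        cases R with
        | nil => exact ⟨L, hLR⟩
        | cons r R =>
          rw [hLR, List.pairwise_append] at hsortA₁
          have h1 := (List.pairwise_cons.1 hsortA₁.2.1).1 r (by simp)
          have h2 := hmem₁ r (by simp [hLR])
          omega
      rw [hrun]
      refine ⟨?_, (Avoids231.reverse_append (A := []) (by simpa using hsortA₁) hB
        (by simpa using hsep₁)).1, ?_, ?_, ?_⟩
      · refine ((List.reverse_perm A₁).append_right B).trans ?_
        simpa [hq0] using hperm₁
      · simp [hL]
      · rw [hstarts, hhead, hrise _ [] (by rw [List.append_nil]; exact hhead)]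
        simp [intervalStarts]
      · have h1 := hnb _ [] (by rw [List.append_nil]; exact hhead)
        simp only [← hhead] at h1
        rw [h1, List.filter_append]
        have h2 : A₁.reverse.filter (fun x => x = n ∨ x ∈ M) = [n] := by
          rw [hL, List.reverse_append, List.reverse_singleton, List.singleton_append,
            List.filter_cons_of_pos (by simp), List.filter_eq_nil_iff.2]
          intro x hx
          rw [List.mem_reverse] at hx
          have h3 : x ∉ M := hAM x (by simp [hL, hx])
          have h4 : x ≠ n := by
            rw [hL, List.pairwise_append] at hsortA₁
            exact (hsortA₁.2.2 x hx n (by simp)).ne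
          simp [h3, h4]
        have h3 : B.filter (fun x => x = n ∨ x ∈ M) = B.filter (· ∈ M) := by
          refine List.filter_congr fun x hx => ?_
          have : x ≠ n := fun e => hnB (e ▸ hx)
          simp [this]
        rw [h2, h3, List.singleton_append]
        congr 1
        simp [hL]
    -- Fewer than `cs.length` letters of `M` are still to be pushed, while `cs.length` of them are
    -- not yet on `B`; so one lies on the stack and ends this stage.
    · have hv := hvalid [c' + 1] cs rfl (by simp) hcs
      rw [hq] at hv
      have hpos₁ : 0 < A₁.countP (· ∈ M) := by omega
      obtain ⟨x, hx, hxM⟩ := List.countP_pos_iff.1 hpos₁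
      obtain ⟨m, hfind⟩ := Option.isSome_iff_exists.1
        (List.find?_isSome (p := (decide <| · ∈ M)).2 ⟨x, hx, hxM⟩)
      obtain ⟨hm, P, A', hPA, hP⟩ := List.find?_eq_some_iff_append.1 hfind
      have hm : m ∈ M := by simpa using hm
      have hP : ∀ x ∈ P, x ∉ M := by simpa using hP
      have hrun : runStacks M ((c' + 1) :: cs) (q + (c' + 1)) A B =
          runStacks M cs q A' ((P ++ [m]).reverse ++ B) := by
        simp [runStacks, hpush, ← hA₁, hPA, transferWhile_append_cons hP hm, transferOne]
      have hPA' : A₁ = (P ++ [m]) ++ A' := by simp [hPA]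
      obtain ⟨Q, hQ⟩ : ∃ Q, P ++ [m] = (q + 1) :: Q := by
        cases P with
        | nil =>
          rw [hPA, List.nil_append, List.cons.injEq] at hhead
          exact ⟨[], by simp [hhead.1]⟩
        | cons y P =>
          rw [hPA, List.cons_append, List.cons.injEq] at hhead
          exact ⟨P ++ [m], by simp [hhead.1]⟩
      have hlast : ((q + 1) :: Q).getLastD 0 = m := by
        simp [← hQ]
      have hsortA' := hPA' ▸ hsortA₁
      obtain ⟨hav, hsep'⟩ := Avoids231.reverse_append hsortA' hB (hPA' ▸ hsep₁)
      rw [hrun]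
      have key := ih q A' ((P ++ [m]).reverse ++ B) hcs (fun c hc => hpos c (by simp [hc])) hq
        (by omega) (List.pairwise_append.1 hsortA').2.1 ?_ hav hsep' ?_ ?_ ?_ ?_
      · obtain ⟨k1, k2, k3, k4, k5⟩ := key
        refine ⟨k1, k2, k3, ?_, k5⟩
        rw [k4, hstarts, hQ, hrise Q A' (hQ ▸ hPA')]
        simp
      · refine List.Perm.trans ?_ hperm₁
        rw [hPA', ← List.append_assoc]
        exact (List.perm_append_comm.trans ((List.reverse_perm _).append_right _)).append_right _
      · rw [hQ, hnb Q A' (hQ ▸ hPA'), ← hQ, List.filter_append]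
        have hPM : P.reverse.filter (· ∈ M) = [] := by
          rw [List.filter_eq_nil_iff]
          intro x hx
          simpa using hP x (by simpa using hx)
        simp only [hQ, hlast]
        rw [← hQ, List.reverse_append, List.reverse_singleton, List.singleton_append,
          List.filter_cons_of_pos (by simpa using hm), hPM]
        rfl
      -- The letters moved before `m` are below `m ≤ n`, and `m ≠ n` because `n ∉ M`; hence `n` is
      -- still on the stack.
      · right
        rw [hPA] at hn₁
        simp only [List.mem_append, List.mem_cons] at hn₁
        rcases hn₁ with h | h | h
        · exfalso
          rw [List.pairwise_append] at hsortA'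
          rw [hPA, List.pairwise_append] at hsortA₁
          have h1 := hsortA₁.2.2 n h m (by simp)
          have h2 := hmem₁ m (by simp [hPA])
          omega
        · exact absurd (h ▸ hm) hnM
        · exact h
      · rw [hPA, List.countP_append, List.countP_cons_of_pos (by simpa using hm)] at hcount₁
        have : P.countP (· ∈ M) = 0 := by simpa [List.countP_eq_zero] using hP
        omega
      · intro s₁ s₂ e h1 h2
        exact hvalid ((c' + 1) :: s₁) s₂ (by simp [e]) (by simp) h2

/-! ### The map `θ` -/

theorem mem_risePositions_one {w : List ℕ} {j : ℕ} :
    j ∈ risePositions 1 w ↔ j ∈ Asc w ∨ w ≠ [] ∧ j = w.length := by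
  by_cases hj : 1 ≤ j ∧ j ≤ w.length
  · obtain ⟨i, rfl⟩ : ∃ i, j = 1 + i := ⟨j - 1, by omega⟩
    have hi : i < w.length := by omega
    obtain ⟨u, y, v, hw, hu⟩ : ∃ u y v, w = u ++ y :: v ∧ u.length = i :=
      ⟨w.take i, w[i], w.drop (i + 1), by simp, by simp; omega⟩
    subst hu
    rw [hw, mem_risePositions_append_cons, Asc]
    cases v <;> simp [Nat.add_comm 1]
  · constructor
    · intro h
      have := risePositions_bounds h
      omega
    · rintro (h | ⟨h, rfl⟩)
      · simp only [Asc, Finset.mem_filter, Finset.mem_Ico] at h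
        omega
      · exact absurd ⟨List.length_pos_iff.2 h, le_rfl⟩ hj

theorem length_notMem_Asc (w : List ℕ) : w.length ∉ Asc w := by
  simp [Asc]

/-- Let `x = 1 + cs.sum` be the next rise letter. The shortest prefix containing all letters below
`x` has exactly the rises below `x`, hence `cs.length` rise positions. It also contains `n ≥ x`, the
first letter, so its own length is a rise position beyond `cs.sum`; the ascents up to `cs.sum`
account for at most the others. -/
theorem countP_mem_Asc_lt {n : ℕ} {w cs ds : List ℕ} (h : Avoids231 w)
    (hp : w.Perm (List.range' 1 n)) (hhead : w.head? = some n)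
    (hst : intervalStarts 1 (cs ++ ds) = riseLetters w) (hpos : ∀ c ∈ cs, 0 < c)
    (hcs : cs ≠ []) (hds : ds ≠ []) :
    (List.range' 1 cs.sum).countP (· ∈ Asc w) < cs.length := by
  have hn : w.Nodup := hp.nodup_iff.2 (List.nodup_range' ..)
  obtain ⟨x, hx⟩ : ∃ x, x = 1 + cs.sum := ⟨_, rfl⟩
  have hsorted := h.riseLetters_pairwise hn
  obtain ⟨rest, hrest⟩ : ∃ rest, riseLetters w = intervalStarts 1 cs ++ x :: rest := by
    cases ds with
    | nil => exact absurd rfl hds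
    | cons d ds => exact ⟨_, by rw [← hst, intervalStarts_append, intervalStarts, ← hx]⟩
  have hxw : x ∈ w := (riseLetters_sublist w).subset (by simp [hrest])
  have hxn := hp.mem_iff.1 hxw
  rw [List.mem_range'_1] at hxn
  have hsum : 0 < cs.sum := by
    cases cs with
    | nil => exact absurd rfl hcs
    | cons c cs =>
      have := hpos c (by simp)
      rw [List.sum_cons]
      omega
  -- split off the shortest prefix that contains all letters below `x`
  have h1w : 1 ∈ w.reverse := by
    rw [List.mem_reverse, hp.mem_iff, List.mem_range'_1]; omega
  obtain ⟨z, hfind⟩ := Option.isSome_iff_exists.1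
    (List.find?_isSome (p := (decide <| · < x)).2 ⟨1, h1w, by simp; omega⟩)
  obtain ⟨hz, as, bs, hab, has⟩ := List.find?_eq_some_iff_append.1 hfind
  obtain ⟨u, v, hw, hv⟩ : ∃ u v, w = u ++ [z] ++ v ∧ ∀ y ∈ v, x ≤ y :=
    ⟨bs.reverse, as.reverse, by simpa using congrArg List.reverse hab, by simpa using has⟩
  have hz : z < x := by simpa using hz
  have hbd : ∀ a ∈ (u ++ [z]).getLast?, ∀ b ∈ v.head?, a < b := by
    intro a ha b hb
    have : a = z := by simpa [eq_comm] using ha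
    have := hv b (List.mem_of_mem_head? hb)
    omega
  have hzu : z ∈ riseLetters (u ++ [z]) := by
    have := getLast?_riseLetters (u ++ [z])
    rw [List.getLast?_append] at this
    exact List.mem_of_getLast? (by simpa using this)
  have hnu : (u ++ [z]).Nodup := hn.sublist (hw ▸ List.sublist_append_left _ _)
  have hsplit : riseLetters w = riseLetters (u ++ [z]) ++ riseLetters v := by
    conv_lhs => rw [hw]
    exact riseLetters_append hbd
  have hsmall : ∀ y ∈ riseLetters (u ++ [z]), y < x := by
    intro y hy
    by_cases hyz : y = z
    · omega
    have hyu : y ∈ u := by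
      have := (riseLetters_sublist _).subset hy
      simpa [hyz] using this
    obtain ⟨s, r, rfl⟩ := List.append_of_mem hyu
    have hav : Avoids231 (s ++ y :: r ++ [z]) := h.sublist (hw ▸ List.sublist_append_left _ _)
    simp only [List.append_assoc, List.cons_append] at hav hnu hy
    have := hav.lt_of_mem_riseLetters hnu hy z (by simp)
    omega
  have hfil : riseLetters (u ++ [z]) = intervalStarts 1 cs := by
    have e1 : (riseLetters w).filter (· < x) = riseLetters (u ++ [z]) := by
      rw [hsplit, List.filter_append, List.filter_eq_self.2 (by simpa using hsmall),
        List.filter_eq_nil_iff.2, List.append_nil]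
      intro y hy
      simpa using hv y ((riseLetters_sublist v).subset hy)
    have e2 : (riseLetters w).filter (· < x) = intervalStarts 1 cs := by
      rw [hrest, List.pairwise_append, List.pairwise_cons] at hsorted
      rw [hrest, List.filter_append, List.filter_eq_self.2, List.filter_eq_nil_iff.2,
        List.append_nil]
      · intro y hy
        rcases List.mem_cons.1 hy with rfl | hy
        · simp
        · simpa using (hsorted.2.1.1 y hy).le
      · intro y hy
        simpa using hsorted.2.2 y hy x (by simp)
    rw [← e1, e2]
  have hlen : (risePositions 1 (u ++ [z])).length = cs.length := by
    rw [length_risePositions, hfil, length_intervalStarts]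
  -- this prefix has at least `x` letters
  have hxu : x ≤ (u ++ [z]).length := by
    have hsub : (List.range' 1 cs.sum ++ [n]).Subperm (u ++ [z]) := by
      refine List.subperm_of_subset ?_ ?_
      · refine List.nodup_append.2 ⟨List.nodup_range' .., by simp, ?_⟩
        intro a ha b hb
        rw [List.mem_range'_1] at ha
        rw [List.mem_singleton] at hb
        omega
      · intro y hy
        rcases List.mem_append.1 hy with hy | hy
        · rw [List.mem_range'_1] at hy
          have : y ∈ w := by rw [hp.mem_iff, List.mem_range'_1]; omega
          rw [hw, List.mem_append] at this
          refine this.resolve_right fun hyv => ?_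
          have := hv y hyv
          omega
        · rw [List.mem_singleton] at hy
          subst hy
          rw [hw, List.head?_append_of_ne_nil _ (by simp)] at hhead
          exact List.mem_of_mem_head? hhead
    have := hsub.length_le
    simp only [List.length_append, List.length_range', List.length_singleton] at this ⊢
    omega
  have hpos' : risePositions 1 w =
      risePositions 1 (u ++ [z]) ++ risePositions (1 + (u ++ [z]).length) v := by
    conv_lhs => rw [hw]
    exact risePositions_append hbd
  rw [List.countP_eq_length_filter, ← hlen]
  have hsub : ((u ++ [z]).length :: (List.range' 1 cs.sum).filter (· ∈ Asc w)).Subperm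
      (risePositions 1 (u ++ [z])) := by
    refine List.subperm_of_subset ?_ ?_
    · refine List.nodup_cons.2 ⟨?_, (List.nodup_range' ..).filter _⟩
      rw [List.mem_filter, List.mem_range'_1]
      omega
    · intro j hj
      rcases List.mem_cons.1 hj with rfl | hj
      · exact mem_risePositions_one.2 (Or.inr ⟨by simp, rfl⟩)
      · rw [List.mem_filter, List.mem_range'_1, decide_eq_true_eq] at hj
        have hjw : j ∈ risePositions 1 w := mem_risePositions_one.2 (Or.inl hj.2)
        rw [hpos', List.mem_append] at hjw
        refine hjw.resolve_right fun hjv => ?_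
        have := risePositions_bounds hjv
        omega
  have := hsub.length_le
  rw [List.length_cons] at this
  omega

/-- `v` is a `231`-avoiding rearrangement of `w` with the same letters not being descent tops,
and whose letters that are not descent bottoms are the positions of these letters in `w`. -/
structure IsRiseTransfer (w v : List ℕ) : Prop where
  perm : v.Perm w
  avoids : Avoids231 v
  letters : riseLetters v = riseLetters w
  positions : (nonBottoms 0 v).Perm (risePositions 1 w)

/-- The ascents together with `n` are the rise positions of `w`, so the algorithm has one more stage
than there are ascents, and its non-bottoms are the rise positions. -/
theorem isRiseTransfer_thetaPrime {n : ℕ} {w : List ℕ} (h : Avoids231 w)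
    (hp : w.Perm (List.range' 1 n)) (hhead : w.head? = some n) :
    IsRiseTransfer w (thetaPrime w) := by
  have hlen : w.length = n := by simpa using hp.length_eq
  have hne : w ≠ [] := by rintro rfl; simp at hhead
  have hposn : 0 < n := hlen ▸ List.length_pos_iff.2 hne
  obtain ⟨cs, hruns, hst, hpos, hsum⟩ := h.exists_inverseDescentRuns hp
  obtain ⟨M, hM⟩ : ∃ M, M = (Asc w).sort (· ≥ ·) := ⟨_, rfl⟩
  have hmem : ∀ j, j ∈ M ↔ j ∈ Asc w := fun j => by rw [hM]; simp
  have hnM : n ∉ M := by rw [hmem, ← hlen]; exact length_notMem_Asc w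
  have hfun : (fun j => decide (j ∈ M)) = fun j => decide (j ∈ Asc w) := by
    funext j; simp [hmem]
  have hθ : thetaPrime w = runStacks M cs.reverse n [] [] := by
    simp [thetaPrime, thetaPrimeOne, thetaPrimeTwo, hruns, hlen, hM]
  have hcslen : cs.length = (risePositions 1 w).length := by
    rw [length_risePositions, ← hst, length_intervalStarts]
  have hperm : (n :: (List.range' 1 n).filter (· ∈ M)).Perm (risePositions 1 w) := by
    rw [List.perm_ext_iff_of_nodup]
    · intro j
      rw [mem_risePositions_one, List.mem_cons, List.mem_filter, List.mem_range'_1,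
        decide_eq_true_eq, hmem, hlen]
      have : j ∈ Asc w → 1 ≤ j ∧ j < 1 + n := fun hj => by
        simp only [Asc, Finset.mem_filter, Finset.mem_Ico] at hj
        omega
      tauto
    · refine List.nodup_cons.2 ⟨?_, (List.nodup_range' ..).filter _⟩
      simp [hnM]
    · exact (risePositions_pairwise 1 w).nodup
  have hcsne : cs ≠ [] := by rintro rfl; simp at hsum; omega
  obtain ⟨k1, k2, k3, k4, k5⟩ := runStacks_spec hnM cs.reverse n [] [] (by simpa using hcsne)
    (by simpa using hpos) (by simpa using hsum) le_rfl (by simp) (by simp) trivial (by simp)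
    (by simp [nonBottoms]) (Or.inl rfl)
    (by
      have := hperm.length_eq
      rw [List.length_cons] at this
      rw [List.countP_nil, List.countP_eq_length_filter, List.length_reverse, hcslen, ← this]
      omega)
    (by
      intro s₁ s₂ e h1 h2
      have e' : cs = s₂.reverse ++ s₁.reverse := by
        rw [← List.reverse_append, ← e, List.reverse_reverse]
      have := countP_mem_Asc_lt h hp hhead (cs := s₂.reverse) (ds := s₁.reverse) (e' ▸ hst)
        (fun c hc => hpos c (by rw [e']; exact List.mem_append_left _ hc))
        (by simpa using h2) (by simpa using h1)
      rw [hfun]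
      simpa using this)
  rw [hθ]
  refine ⟨k1.trans hp.symm, k2, ?_, ?_⟩
  · rw [k4, List.reverse_reverse, hst]
    simp [riseLetters]
  · rw [k5]
    refine (k1.filter _).trans (List.Perm.trans ?_ hperm)
    rw [List.perm_ext_iff_of_nodup ((List.nodup_range' ..).filter _)
      (List.nodup_cons.2 ⟨by simp [hnM], (List.nodup_range' ..).filter _⟩)]
    intro j
    simp only [List.mem_filter, List.mem_range'_1, List.mem_cons, decide_eq_true_eq]
    constructor
    · tauto
    · rintro (rfl | h)
      · exact ⟨by omega, Or.inl rfl⟩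
      · tauto

theorem IsRiseTransfer.directSum {m n : ℕ} {u u' v v' : List ℕ} (hu : IsRiseTransfer u u')
    (hv : IsRiseTransfer v v') (hpu : u.Perm (List.range' 1 m)) (hpv : v.Perm (List.range' 1 n)) :
    IsRiseTransfer (directSum u v) (directSum u' v') := by
  have hpu' := hu.perm.trans hpu
  have hpv' := hv.perm.trans hpv
  have key : ∀ {u v : List ℕ}, u.Perm (List.range' 1 m) → v.Perm (List.range' 1 n) →
      u.length = m ∧ (∀ b ∈ v.map (· + m), m < b) ∧
      (∀ a ∈ u, ∀ b ∈ v.map (· + m), a < b) := by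
    intro u v h1 h2
    have h3 : ∀ b ∈ v.map (· + m), m < b := by
      intro b hb
      obtain ⟨c, hc, rfl⟩ := List.mem_map.1 hb
      have := h2.mem_iff.1 hc
      rw [List.mem_range'_1] at this
      omega
    refine ⟨by simpa using h1.length_eq, h3, fun a ha b hb => ?_⟩
    have h4 := h1.mem_iff.1 ha
    rw [List.mem_range'_1] at h4
    have := h3 b hb
    omega
  obtain ⟨a1, a2, a3⟩ := key hpu hpv
  obtain ⟨b1, b2, b3⟩ := key hpu' hpv'
  simp only [PermStat.directSum, a1, b1]
  have hbd : ∀ a ∈ u.getLast?, ∀ b ∈ (v.map (· + m)).head?, a < b := fun a ha b hb =>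
    a3 a (List.mem_of_getLast? ha) b (List.mem_of_mem_head? hb)
  have hbd' : ∀ a ∈ u'.getLast?, ∀ b ∈ (v'.map (· + m)).head?, a < b := fun a ha b hb =>
    b3 a (List.mem_of_getLast? ha) b (List.mem_of_mem_head? hb)
  refine ⟨hu.perm.append (hv.perm.map _), ?_, ?_, ?_⟩
  · exact hu.avoids.append (hv.avoids.map_of_lt_imp_lt fun x _ y _ h => by omega) b3
  · rw [riseLetters_append hbd, riseLetters_append hbd', riseLetters_map_add,
      riseLetters_map_add, hu.letters, hv.letters]
  -- The bound `0 + m` is chosen to fit the shift lemma `nonBottoms_map_add`.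
  · rw [risePositions_append hbd,
      nonBottoms_append (q := 0 + m) (fun b hb => by have := b2 b hb; omega)
        (fun b hb => by have := b2 b hb; omega) b3, nonBottoms_map_add, a1, risePositions_map_add]
    exact hu.positions.append (hv.positions.map _)

/-! ### Splitting off the first component, and `θ` on all of `Av(231)` -/

theorem eq_filter_append_filter {a : ℕ} {l : List ℕ}
    (h : l.Pairwise (fun b c => ¬ (c < a ∧ a < b))) (ha : a ∉ l) :
    l = l.filter (· < a) ++ l.filter (a < ·) := by
  induction l with
  | nil => simp
  | cons b l ih =>
    rw [List.pairwise_cons] at h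
    rw [List.mem_cons, not_or] at ha
    rcases lt_or_gt_of_ne ha.1 with hb | hb
    · have h1 : l.filter (· < a) = [] := by
        rw [List.filter_eq_nil_iff]
        intro c hc hca
        exact h.1 c hc ⟨by simpa using hca, hb⟩
      have ih := ih h.2 ha.2
      rw [h1, List.nil_append] at ih
      rw [List.filter_cons_of_neg (by simp; omega), List.filter_cons_of_pos (by simpa using hb), h1,
        ← ih]
      rfl
    · rw [List.filter_cons_of_pos (by simpa using hb), List.filter_cons_of_neg (by simp; omega),
        List.cons_append, ← ih h.2 ha.2]

theorem Avoids231.eq_directSum {n a : ℕ} {l : List ℕ} (h : Avoids231 (a :: l))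
    (hp : (a :: l).Perm (List.range' 1 n)) :
    a :: l = directSum (a :: l.take (a - 1)) ((l.drop (a - 1)).map (· - a)) ∧
      (a :: l.take (a - 1)).Perm (List.range' 1 a) ∧
      ((l.drop (a - 1)).map (· - a)).Perm (List.range' 1 (n - a)) := by
  have hn : (a :: l).Nodup := hp.nodup_iff.2 (List.nodup_range' ..)
  have ha := hp.mem_iff.1 (List.mem_cons_self (a := a))
  rw [List.mem_range'_1] at ha
  have hsplit := eq_filter_append_filter h.1 (List.nodup_cons.1 hn).1
  have hsmall : (l.filter (· < a)).Perm (List.range' 1 (a - 1)) := by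
    have h1 := hp.filter (· < a)
    rw [List.filter_cons_of_neg (by simp)] at h1
    refine h1.trans ?_
    rw [List.perm_ext_iff_of_nodup ((List.nodup_range' ..).filter _) (List.nodup_range' ..)]
    intro j
    simp only [List.mem_filter, List.mem_range'_1, decide_eq_true_eq]
    omega
  have hlarge : (l.filter (a < ·)).Perm (List.range' (a + 1) (n - a)) := by
    have h1 := hp.filter (a < ·)
    rw [List.filter_cons_of_neg (by simp)] at h1
    refine h1.trans ?_
    rw [List.perm_ext_iff_of_nodup ((List.nodup_range' ..).filter _) (List.nodup_range' ..)]
    intro j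
    simp only [List.mem_filter, List.mem_range'_1, decide_eq_true_eq]
    omega
  have hlen : (l.filter (· < a)).length = a - 1 := by simpa using hsmall.length_eq
  have htake : l.take (a - 1) = l.filter (· < a) := by
    conv_lhs => rw [hsplit, ← hlen, List.take_left]
  have hdrop : l.drop (a - 1) = l.filter (a < ·) := by
    conv_lhs => rw [hsplit, ← hlen, List.drop_left]
  refine ⟨?_, ?_, ?_⟩
  · rw [directSum, htake, hdrop, List.length_cons, hlen, List.map_map, List.cons_append]
    congr 1
    conv_lhs => rw [hsplit]
    congr 1
    conv_lhs => rw [← List.map_id (l.filter (a < ·))]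
    refine List.map_congr_left fun x hx => ?_
    have : a < x := by simpa using (List.mem_filter.1 hx).2
    simp only [id, Function.comp]
    omega
  · rw [htake]
    refine (hsmall.cons a).trans ?_
    obtain ⟨b, rfl⟩ : ∃ b, a = b + 1 := ⟨a - 1, by omega⟩
    rw [List.range'_concat, Nat.add_sub_cancel, one_mul, Nat.add_comm 1 b]
    exact List.perm_append_comm (l₁ := [b + 1])
  · rw [hdrop]
    refine (hlarge.map _).trans ?_
    rw [List.map_sub_range' (by omega)]
    simp

theorem isRiseTransfer_theta {n : ℕ} {w : List ℕ} (h : Avoids231 w)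
    (hp : w.Perm (List.range' 1 n)) : IsRiseTransfer w (theta w) := by
  induction w using components.induct generalizing n with
  | case1 =>
    simp only [theta, components, List.map_nil, List.foldr_nil]
    exact ⟨List.Perm.refl _, trivial, rfl, by simp [nonBottoms, risePositions]⟩
  | case2 a l ih =>
    obtain ⟨h1, h2, h3⟩ := h.eq_directSum hp
    have hθ : theta (a :: l) = directSum (thetaPrime (a :: l.take (a - 1)))
        (theta ((l.drop (a - 1)).map (· - a))) := by
      simp only [theta, components, List.map_cons, List.foldr_cons]
    rw [hθ]
    conv_lhs => rw [h1]
    refine IsRiseTransfer.directSum (isRiseTransfer_thetaPrime ?_ h2 (by simp)) (ih ?_ h3) h2 h3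
    · exact h.sublist ((List.take_sublist _ _).cons_cons a)
    · exact (h.2.sublist (List.drop_sublist _ _)).map_of_lt_imp_lt fun x _ y _ h => by omega

/-- The rises of `w` and their positions can be read off `theta w`; the positions come only as a
set, which suffices since they are listed in increasing order. -/
theorem theta_injOn {n : ℕ} {w w' : List ℕ} (h : Avoids231 w) (h' : Avoids231 w')
    (hp : w.Perm (List.range' 1 n)) (hp' : w'.Perm (List.range' 1 n))
    (e : theta w = theta w') : w = w' := by
  have t := isRiseTransfer_theta h hp
  have t' := isRiseTransfer_theta h' hp'
  refine h.eq_of_rises_eq h' hp hp' ?_ ?_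
  · rw [← t.letters, ← t'.letters, e]
  · exact List.Perm.eq_of_pairwise (le := (· < ·)) (fun a b _ _ h1 h2 => by omega)
      (risePositions_pairwise 1 w) (risePositions_pairwise 1 w')
      (t.positions.symm.trans (e ▸ t'.positions))

/-! ### Pattern occurrences as sums over positions -/

/-- The triples `p, q, r` and `x, y, z` are in the same relative order. -/
def SameOrder (x y z p q r : ℕ) : Prop :=
  (p < q ↔ x < y) ∧ (q < p ↔ y < x) ∧ (p < r ↔ x < z) ∧ (r < p ↔ z < x) ∧ (q < r ↔ y < z) ∧
    (r < q ↔ z < y)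

instance (x y z p q r : ℕ) : Decidable (SameOrder x y z p q r) := by
  unfold SameOrder; infer_instance

theorem mem_occurrences_three {x y z : ℕ} {adj : Finset ℕ} {w : List ℕ}
    {f : Fin 3 → Fin w.length} :
    f ∈ occurrences [x, y, z] adj w ↔ (f 0 < f 1 ∧ f 1 < f 2) ∧
      SameOrder x y z (w.getD (f 0) 0) (w.getD (f 1) 0) (w.getD (f 2) 0) ∧
      (1 ∈ adj → (f 1 : ℕ) = f 0 + 1) ∧ (2 ∈ adj → (f 2 : ℕ) = f 1 + 1) := by
  simp only [occurrences, Finset.mem_filter, Finset.mem_univ, true_and]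
  have hg : ∀ i : Fin w.length, w.get i = w.getD i 0 := fun i => by simp
  simp only [hg]
  constructor
  · rintro ⟨h1, h2, h3⟩
    refine ⟨⟨h1 (0 : Fin 3) (1 : Fin 3) (show (0 : Fin 3) < 1 by decide),
      h1 (1 : Fin 3) (2 : Fin 3) (show (1 : Fin 3) < 2 by decide)⟩,
      ⟨h2 (0 : Fin 3) (1 : Fin 3), h2 (1 : Fin 3) (0 : Fin 3), h2 (0 : Fin 3) (2 : Fin 3),
        h2 (2 : Fin 3) (0 : Fin 3), h2 (1 : Fin 3) (2 : Fin 3), h2 (2 : Fin 3) (1 : Fin 3)⟩, ?_, ?_⟩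
    · exact fun h => h3 (0 : Fin 3) (1 : Fin 3) h rfl
    · exact fun h => h3 (1 : Fin 3) (2 : Fin 3) h rfl
  · rintro ⟨⟨h01, h12⟩, ⟨k1, k2, k3, k4, k5, k6⟩, h3, h4⟩
    change (∀ a b : Fin 3, _) ∧ (∀ a b : Fin 3, _) ∧ (∀ a b : Fin 3, _)
    refine ⟨?_, ?_, ?_⟩
    · intro (a : Fin 3) (b : Fin 3) (hab : a < b)
      fin_cases a <;> fin_cases b <;>
        first | exact absurd hab (by decide) | exact h01 | exact h12 | exact h01.trans h12
    · intro (a : Fin 3) (b : Fin 3)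
      fin_cases a <;> fin_cases b <;>
        first | exact k1 | exact k2 | exact k3 | exact k4 | exact k5 | exact k6 |
          exact iff_of_false (lt_irrefl _) (lt_irrefl _)
    · intro (a : Fin 3) (b : Fin 3) ha (hb : (b : ℕ) = a + 1)
      fin_cases a <;> fin_cases b <;>
        first | exact absurd hb (by decide) | exact h3 ha | exact h4 ha

theorem avoids_312_iff {w : List ℕ} :
    Avoids [3, 1, 2] w ↔ ∀ i j k, i < j → j < k → k < w.length →
      ¬ (w.getD j 0 < w.getD k 0 ∧ w.getD k 0 < w.getD i 0) := by
  rw [Avoids, Finset.eq_empty_iff_forall_notMem]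
  constructor
  · intro h i j k hij hjk hk hh
    refine h (![⟨i, by omega⟩, ⟨j, by omega⟩, ⟨k, hk⟩] : Fin 3 → Fin w.length)
      (mem_occurrences_three.2 ⟨⟨hij, hjk⟩, ?_, by simp, by simp⟩)
    simp only [SameOrder, Matrix.cons_val]
    omega
  · intro h f hf
    obtain ⟨⟨h1, h2⟩, h3, -⟩ := mem_occurrences_three.1 hf
    simp only [SameOrder] at h3
    exact h _ _ _ h1 h2 (Fin.is_lt _) (by omega)

theorem occ_three_adj_one {x y z : ℕ} {w : List ℕ} :
    occ [x, y, z] {1} w = ∑ i ∈ Finset.range w.length, ((Finset.range w.length).filter fun k =>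
      i + 1 < k ∧ SameOrder x y z (w.getD i 0) (w.getD (i + 1) 0) (w.getD k 0)).card := by
  rw [← Finset.card_sigma, occ]
  refine Finset.card_bij
    (fun (f : Fin 3 → Fin w.length) _ => (⟨(f 0 : ℕ), (f 2 : ℕ)⟩ : Σ _ : ℕ, ℕ)) ?_ ?_ ?_
  · intro f hf
    obtain ⟨⟨h1, h2⟩, h3, h4, -⟩ := mem_occurrences_three.1 hf
    have h4 := h4 (by simp)
    rw [h4] at h3
    have h2 : (f 1 : ℕ) < f 2 := h2
    simp only [Finset.mem_sigma, Finset.mem_filter, Finset.mem_range]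
    exact ⟨Fin.is_lt _, Fin.is_lt _, by omega, h3⟩
  · intro f hf f' hf' e
    obtain ⟨-, -, h4, -⟩ := mem_occurrences_three.1 hf
    obtain ⟨-, -, h4', -⟩ := mem_occurrences_three.1 hf'
    have h4 := h4 (by simp)
    have h4' := h4' (by simp)
    simp only [Sigma.mk.injEq, heq_eq_eq] at e
    funext (a : Fin 3)
    refine Fin.ext ?_
    fin_cases a
    · exact e.1
    · exact h4.trans (by rw [e.1]; exact h4'.symm)
    · exact e.2
  · rintro ⟨i, k⟩ h
    simp only [Finset.mem_sigma, Finset.mem_filter, Finset.mem_range] at h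
    refine ⟨(![⟨i, h.1⟩, ⟨i + 1, by omega⟩, ⟨k, h.2.1⟩] : Fin 3 → Fin w.length),
      mem_occurrences_three.2 ⟨⟨?_, ?_⟩, ?_, ?_, by simp⟩, rfl⟩
    · exact Nat.lt_succ_self i
    · exact h.2.2.1
    · exact h.2.2.2
    · exact fun _ => rfl

theorem occ_three_adj_two {x y z : ℕ} {w : List ℕ} :
    occ [x, y, z] {2} w = ∑ i ∈ Finset.range w.length, ((Finset.range w.length).filter fun k =>
      k < i ∧ i + 1 < w.length ∧
        SameOrder x y z (w.getD k 0) (w.getD i 0) (w.getD (i + 1) 0)).card := by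
  rw [← Finset.card_sigma, occ]
  refine Finset.card_bij
    (fun (f : Fin 3 → Fin w.length) _ => (⟨(f 1 : ℕ), (f 0 : ℕ)⟩ : Σ _ : ℕ, ℕ)) ?_ ?_ ?_
  · intro f hf
    obtain ⟨⟨h1, h2⟩, h3, -, h4⟩ := mem_occurrences_three.1 hf
    have h4 := h4 (by simp)
    rw [h4] at h3
    have h2 : (f 0 : ℕ) < f 1 := h1
    simp only [Finset.mem_sigma, Finset.mem_filter, Finset.mem_range]
    exact ⟨Fin.is_lt _, Fin.is_lt _, h2, by have := (f 2).is_lt; omega, h3⟩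
  · intro f hf f' hf' e
    obtain ⟨-, -, -, h4⟩ := mem_occurrences_three.1 hf
    obtain ⟨-, -, -, h4'⟩ := mem_occurrences_three.1 hf'
    have h4 := h4 (by simp)
    have h4' := h4' (by simp)
    simp only [Sigma.mk.injEq, heq_eq_eq] at e
    funext (a : Fin 3)
    refine Fin.ext ?_
    fin_cases a
    · exact e.2
    · exact e.1
    · exact h4.trans (by rw [e.1]; exact h4'.symm)
  · rintro ⟨i, k⟩ h
    simp only [Finset.mem_sigma, Finset.mem_filter, Finset.mem_range] at h
    refine ⟨(![⟨k, h.2.1⟩, ⟨i, h.1⟩, ⟨i + 1, h.2.2.2.1⟩] : Fin 3 → Fin w.length),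
      mem_occurrences_three.2 ⟨⟨?_, ?_⟩, ?_, by simp, ?_⟩, rfl⟩
    · exact h.2.2.1
    · exact Nat.lt_succ_self i
    · exact h.2.2.2.2
    · exact fun _ => rfl

/-- The descents of a word, positions being counted from `0`. -/
def descents (w : List ℕ) : Finset ℕ :=
  (Finset.range w.length).filter fun i => i + 1 < w.length ∧ w.getD (i + 1) 0 < w.getD i 0

theorem occ_21 (w : List ℕ) : occ [2, 1] {1} w = (descents w).card := by
  rw [occ]
  have hg : ∀ i : Fin w.length, w.get i = w.getD i 0 := fun i => by simp
  refine Finset.card_bij (fun (f : Fin 2 → Fin w.length) _ => (f 0 : ℕ)) ?_ ?_ ?_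
  · intro f hf
    simp only [occurrences, Finset.mem_filter, Finset.mem_univ, true_and, hg] at hf
    obtain ⟨-, h2, h3⟩ := hf
    have h2 := (h2 (1 : Fin 2) (0 : Fin 2)).2 (show 1 < 2 by decide)
    have h3 : (f 1 : ℕ) = f 0 + 1 := h3 (0 : Fin 2) (1 : Fin 2) (by simp) rfl
    rw [h3] at h2
    have := (f 1).is_lt
    simp only [descents, Finset.mem_filter, Finset.mem_range]
    exact ⟨Fin.is_lt _, by omega, h2⟩
  · intro f hf f' hf' e
    simp only [occurrences, Finset.mem_filter, Finset.mem_univ, true_and] at hf hf'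
    have h3 : (f 1 : ℕ) = f 0 + 1 := hf.2.2 (0 : Fin 2) (1 : Fin 2) (by simp) rfl
    have h3' : (f' 1 : ℕ) = f' 0 + 1 := hf'.2.2 (0 : Fin 2) (1 : Fin 2) (by simp) rfl
    funext (a : Fin 2)
    refine Fin.ext ?_
    fin_cases a
    · exact e
    · exact h3.trans (by rw [e]; exact h3'.symm)
  · intro i hi
    simp only [descents, Finset.mem_filter, Finset.mem_range] at hi
    refine ⟨(![⟨i, hi.1⟩, ⟨i + 1, hi.2.1⟩] : Fin 2 → Fin w.length), ?_, rfl⟩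
    simp only [occurrences, Finset.mem_filter, Finset.mem_univ, true_and, hg]
    change (∀ a b : Fin 2, _) ∧ (∀ a b : Fin 2, _) ∧ (∀ a b : Fin 2, _)
    refine ⟨?_, ?_, ?_⟩
    · intro a b hab
      fin_cases a <;> fin_cases b <;>
        first | exact absurd hab (by decide) | exact Nat.lt_succ_self i
    · intro a b
      fin_cases a <;> fin_cases b
      · exact iff_of_false (lt_irrefl _) (by decide)
      · exact iff_of_false (not_lt.2 hi.2.2.le) (by decide)
      · exact iff_of_true hi.2.2 (by decide)
      · exact iff_of_false (lt_irrefl _) (by decide)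
    · intro (a : Fin 2) (b : Fin 2) ha (hb : (b : ℕ) = a + 1)
      fin_cases a <;> fin_cases b <;>
        first | exact absurd hb (by decide) | rfl

/-! ### The statistics on words avoiding `312` -/

theorem card_filter_getD (w : List ℕ) (p : ℕ → Prop) [DecidablePred p] :
    ((Finset.range w.length).filter fun k => p (w.getD k 0)).card = w.countP p := by
  rw [Finset.card_filter]
  induction w with
  | nil => simp
  | cons a w ih =>
    rw [List.length_cons, Finset.sum_range_succ', List.countP_cons, ← ih]
    simp

theorem card_filter_getD_of_perm {w : List ℕ} {n : ℕ} (hp : w.Perm (List.range' 1 n))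
    (p : ℕ → Prop) [DecidablePred p] :
    ((Finset.range w.length).filter fun k => p (w.getD k 0)).card =
      ((Finset.Icc 1 n).filter p).card := by
  rw [card_filter_getD, hp.countP_eq, List.countP_eq_length_filter,
    ← List.toFinset_card_of_nodup ((List.nodup_range' ..).filter _)]
  congr 1
  ext j
  simp only [List.mem_toFinset, List.mem_filter, List.mem_range'_1, decide_eq_true_eq,
    Finset.mem_filter, Finset.mem_Icc]
  constructor <;> rintro ⟨h1, h2⟩ <;> exact ⟨by omega, h2⟩

theorem card_lt_getD {w : List ℕ} {n m : ℕ} (hp : w.Perm (List.range' 1 n)) (hm : m ≤ n) :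
    ((Finset.range w.length).filter fun k => w.getD k 0 < m).card = m - 1 := by
  rw [card_filter_getD_of_perm hp (· < m)]
  have : (Finset.Icc 1 n).filter (· < m) = Finset.Ico 1 m := by
    ext j; simp only [Finset.mem_filter, Finset.mem_Icc, Finset.mem_Ico]; omega
  rw [this, Nat.card_Ico]

theorem card_gt_getD {w : List ℕ} {n m : ℕ} (hp : w.Perm (List.range' 1 n)) :
    ((Finset.range w.length).filter fun k => m < w.getD k 0).card = n - m := by
  rw [card_filter_getD_of_perm hp (m < ·)]
  have : (Finset.Icc 1 n).filter (m < ·) = Finset.Ioc m n := by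
    ext j; simp only [Finset.mem_filter, Finset.mem_Icc, Finset.mem_Ioc]; omega
  rw [this, Nat.card_Ioc]

theorem getD_bounds {w : List ℕ} {n i : ℕ} (hp : w.Perm (List.range' 1 n)) (hi : i < w.length) :
    1 ≤ w.getD i 0 ∧ w.getD i 0 ≤ n := by
  have := hp.mem_iff.1 (List.getElem_mem hi)
  rw [List.mem_range'_1] at this
  rw [List.getD_eq_getElem _ _ hi]
  omega

theorem getD_ne {w : List ℕ} {i j : ℕ} (hn : w.Nodup) (hi : i < w.length) (hj : j < w.length)
    (hij : i ≠ j) : w.getD i 0 ≠ w.getD j 0 := by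
  rw [List.getD_eq_getElem _ _ hi, List.getD_eq_getElem _ _ hj]
  exact fun e => hij ((hn.getElem_inj_iff).1 e)

/-- At a descent `i`, every later position `k > i + 1` completes a `213` or a `321`, the remaining
option `312` being excluded. With the descent itself this gives `w.length - 1 - i`, positions being
counted from `0`. -/
theorem bast_eq {w : List ℕ} (hn : w.Nodup) (h : Avoids [3, 1, 2] w) :
    bast w = occ [1, 3, 2] {1} w + ∑ i ∈ descents w, (w.length - 1 - i) := by
  rw [avoids_312_iff] at h
  rw [bast, add_assoc, add_assoc]
  congr 1
  rw [occ_three_adj_one, occ_three_adj_one, occ_21, Finset.card_eq_sum_ones, descents,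
    Finset.sum_filter, Finset.sum_filter, ← Finset.sum_add_distrib, ← Finset.sum_add_distrib]
  refine Finset.sum_congr rfl fun i hi => ?_
  rw [Finset.mem_range] at hi
  split_ifs with hd
  · rw [← add_assoc, ← Finset.card_union_of_disjoint]
    · have : ((Finset.range w.length).filter fun k =>
          i + 1 < k ∧ SameOrder 2 1 3 (w.getD i 0) (w.getD (i + 1) 0) (w.getD k 0)) ∪
          ((Finset.range w.length).filter fun k =>
          i + 1 < k ∧ SameOrder 3 2 1 (w.getD i 0) (w.getD (i + 1) 0) (w.getD k 0)) =
          Finset.Ico (i + 2) w.length := by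
        ext k
        simp only [Finset.mem_union, Finset.mem_filter, Finset.mem_range, Finset.mem_Ico]
        simp only [SameOrder]
        constructor
        · omega
        · rintro ⟨h1, h2⟩
          have h3 := h i (i + 1) k (by omega) (by omega) h2
          have h4 := getD_ne hn hi h2 (by omega)
          have h5 := getD_ne hn hd.1 h2 (by omega)
          omega
      rw [this, Nat.card_Ico]
      omega
    · rw [Finset.disjoint_left]
      intro k
      simp only [Finset.mem_filter]
      simp only [SameOrder]
      omega
  · rw [Finset.filter_eq_empty_iff.2, Finset.filter_eq_empty_iff.2]
    · rfl
    all_goals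
      intro k hk
      rw [Finset.mem_range] at hk
      simp only [SameOrder]
      omega

/-- Each letter larger than the descent top completes a `213` if it stands to the right and a `321`
if it stands to the left. The descent itself adds one. -/
theorem foze_eq {w : List ℕ} {n : ℕ} (hp : w.Perm (List.range' 1 n)) :
    foze w = occ [1, 3, 2] {1} w + ∑ i ∈ descents w, (n + 1 - w.getD i 0) := by
  have hn : w.Nodup := hp.nodup_iff.2 (List.nodup_range' ..)
  rw [foze, add_right_comm, add_comm _ (occ [1, 3, 2] {1} w)]
  congr 1
  rw [occ_three_adj_one, occ_three_adj_two, occ_21, Finset.card_eq_sum_ones, descents,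
    Finset.sum_filter, Finset.sum_filter, ← Finset.sum_add_distrib, ← Finset.sum_add_distrib]
  refine Finset.sum_congr rfl fun i hi => ?_
  rw [Finset.mem_range] at hi
  split_ifs with hd
  · rw [← Finset.card_union_of_disjoint]
    · have : ((Finset.range w.length).filter fun k =>
          i + 1 < k ∧ SameOrder 2 1 3 (w.getD i 0) (w.getD (i + 1) 0) (w.getD k 0)) ∪
          ((Finset.range w.length).filter fun k => k < i ∧ i + 1 < w.length ∧
          SameOrder 3 2 1 (w.getD k 0) (w.getD i 0) (w.getD (i + 1) 0)) =
          (Finset.range w.length).filter fun k => w.getD i 0 < w.getD k 0 := by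
        ext k
        simp only [Finset.mem_union, Finset.mem_filter, Finset.mem_range]
        simp only [SameOrder]
        constructor
        · omega
        · rintro ⟨h1, h2⟩
          have h3 : k ≠ i := by rintro rfl; omega
          have h4 : k ≠ i + 1 := by rintro rfl; omega
          omega
      rw [this, card_gt_getD hp]
      have := getD_bounds hp hi
      omega
    · rw [Finset.disjoint_left]
      intro k
      simp only [Finset.mem_filter]
      omega
  · rw [Finset.filter_eq_empty_iff.2, Finset.filter_eq_empty_iff.2]
    · rfl
    all_goals
      intro k hk
      rw [Finset.mem_range] at hk
      simp only [SameOrder]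
      omega

/-- Avoiding `312` means that before any `w_k` the smaller letters all precede the larger ones. If
`k` is a descent bottom, there are larger letters before it: either they start at the first letter,
so `w_k < w_0`, or there is exactly one step from smaller to larger, that is, one `132` ending at
`k`. Otherwise all earlier letters are smaller and neither happens. Summing over `k`, the first case
occurs `w_0 - 1` times. -/
theorem occ_132_add {w : List ℕ} {n : ℕ} (hp : w.Perm (List.range' 1 n)) (hpos : 1 ≤ n)
    (h : Avoids [3, 1, 2] w) :
    occ [1, 3, 2] {1} w + w.getD 0 0 = (descents w).card + 1 := by
  have hn : w.Nodup := hp.nodup_iff.2 (List.nodup_range' ..)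
  have hlen : w.length = n := by simpa using hp.length_eq
  rw [avoids_312_iff] at h
  have h0 := getD_bounds hp (i := 0) (by omega)
  have hcard := card_lt_getD hp h0.2
  have hocc : occ [1, 3, 2] {1} w = ∑ k ∈ Finset.range w.length,
      ((Finset.range w.length).filter fun i => i + 1 < k ∧ w.getD i 0 < w.getD k 0 ∧
        w.getD k 0 < w.getD (i + 1) 0).card := by
    simp only [occ_three_adj_one, Finset.card_filter]
    rw [Finset.sum_comm]
    refine Finset.sum_congr rfl fun k _ => Finset.sum_congr rfl fun i _ => ?_
    congr 1
    simp only [SameOrder, eq_iff_iff]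
    omega
  have hdes : (descents w).card = ∑ k ∈ Finset.range w.length,
      if 1 ≤ k ∧ w.getD k 0 < w.getD (k - 1) 0 then 1 else 0 := by
    rw [← Finset.card_filter]
    refine Finset.card_bij (fun i _ => i + 1) ?_ (fun _ _ _ _ e => by simpa using e) ?_
    · intro i hi
      simp only [descents, Finset.mem_filter, Finset.mem_range] at hi ⊢
      simpa using hi.2
    · intro k hk
      simp only [descents, Finset.mem_filter, Finset.mem_range] at hk ⊢
      refine ⟨k - 1, ⟨by omega, by omega, ?_⟩, by omega⟩
      rw [show k - 1 + 1 = k by omega]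
      exact hk.2.2
  suffices hs : ∀ k ∈ Finset.range w.length,
      ((Finset.range w.length).filter fun i => i + 1 < k ∧ w.getD i 0 < w.getD k 0 ∧
        w.getD k 0 < w.getD (i + 1) 0).card + (if w.getD k 0 < w.getD 0 0 then 1 else 0) =
      if 1 ≤ k ∧ w.getD k 0 < w.getD (k - 1) 0 then 1 else 0 by
    have := Finset.sum_congr rfl hs
    rw [Finset.sum_add_distrib, ← Finset.card_filter (fun k => w.getD k 0 < w.getD 0 0), hcard,
      ← hocc, ← hdes] at this
    omega
  intro k hk
  rw [Finset.mem_range] at hk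
  by_cases hd : 1 ≤ k ∧ w.getD k 0 < w.getD (k - 1) 0
  · rw [if_pos hd]
    have hex : ∃ j, w.getD k 0 < w.getD j 0 := ⟨k - 1, hd.2⟩
    obtain ⟨j, hj, hmin⟩ : ∃ j, w.getD k 0 < w.getD j 0 ∧ ∀ i < j, ¬ w.getD k 0 < w.getD i 0 :=
      ⟨Nat.find hex, Nat.find_spec hex, fun i hi => Nat.find_min hex hi⟩
    have hjk : j ≤ k - 1 := by
      by_contra hlt
      exact hmin (k - 1) (by omega) hd.2
    -- Here `j` is the first position whose letter exceeds `w_k`; the unique `132` ending at `k`, if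
    -- any, crosses into `j`.
    cases j with
    | zero =>
      rw [if_pos hj, Finset.filter_eq_empty_iff.2]
      · rfl
      intro i _ hi
      rcases Nat.eq_zero_or_pos i with rfl | hi0
      · omega
      · exact h 0 i k hi0 (by omega) hk ⟨hi.2.1, hj⟩
    | succ j =>
      have h1 := hmin j (by omega)
      have h2 := getD_ne hn (i := j) (j := k) (by omega) hk (by omega)
      rw [if_neg (hmin 0 (by omega)), add_zero, Finset.card_eq_one]
      refine ⟨j, ?_⟩
      ext i
      simp only [Finset.mem_filter, Finset.mem_range, Finset.mem_singleton]
      constructor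
      · rintro ⟨_, h3, h4, h5⟩
        by_contra hne
        rcases lt_or_gt_of_ne hne with hlt | hlt
        · exact hmin (i + 1) (by omega) h5
        · have : i ≠ j + 1 := by rintro rfl; omega
          exact h (j + 1) i k (by omega) (by omega) hk ⟨h4, hj⟩
      · rintro rfl
        exact ⟨by omega, by omega, by omega, hj⟩
  · rw [if_neg hd, if_neg, Finset.filter_eq_empty_iff.2]
    · rfl
    · intro i _ hi
      have h1 := getD_ne hn (i := k - 1) (j := k) (by omega) hk (by omega)
      have : i + 1 ≠ k - 1 := fun e => hd ⟨by omega, by rw [← e]; exact hi.2.2⟩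
      exact h (i + 1) (k - 1) k (by omega) (by omega) hk ⟨by omega, hi.2.2⟩
    · intro hlt
      have hk0 : k ≠ 0 := by rintro rfl; omega
      have h1 := getD_ne hn (i := k - 1) (j := k) (by omega) hk (by omega)
      have : k - 1 ≠ 0 := fun e => hd ⟨by omega, by rw [e]; exact hlt⟩
      exact h 0 (k - 1) k (by omega) (by omega) hk ⟨by omega, hlt⟩

/-! ### Sums over descents -/

theorem sum_descents_cons (a : ℕ) (w : List ℕ) (f : ℕ → ℕ) :
    ∑ i ∈ descents (a :: w), f i =
      ∑ i ∈ descents w, f (i + 1) + if 0 < w.length ∧ w.getD 0 0 < a then f 0 else 0 := by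
  simp only [descents, Finset.sum_filter, List.length_cons]
  rw [Finset.sum_range_succ']
  simp

theorem isRise_iff_of_nodup {a : ℕ} {w : List ℕ} (h : (a :: w).Nodup) :
    IsRise a w ↔ ¬ (0 < w.length ∧ w.getD 0 0 < a) := by
  cases w with
  | nil => simp
  | cons b w =>
    simp only [List.nodup_cons, List.mem_cons, not_or] at h
    simp
    omega

/-- Every position carries either a descent top or a rise. -/
theorem sum_descents_add_risePositions {w : List ℕ} (h : w.Nodup) (j : ℕ) :
    ∑ i ∈ descents w, (i + j) + (risePositions j w).sum = (List.range' j w.length).sum := by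
  induction w generalizing j with
  | nil => simp [descents, risePositions]
  | cons a w ih =>
    have ih := ih h.of_cons (j + 1)
    rw [sum_descents_cons, risePositions, List.length_cons, List.range'_succ, List.sum_cons, ← ih]
    simp only [isRise_iff_of_nodup h, ite_not]
    have : ∀ i, i + 1 + j = i + (j + 1) := fun i => by omega
    simp only [this]
    split_ifs
    · omega
    · rw [List.sum_cons]; omega

theorem card_descents_add_riseLetters {w : List ℕ} (h : w.Nodup) :
    (descents w).card + (riseLetters w).length = w.length := by
  induction w with
  | nil => simp [descents, riseLetters]
  | cons a w ih =>
    have ih := ih h.of_cons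
    rw [Finset.card_eq_sum_ones] at ih ⊢
    rw [sum_descents_cons, riseLetters, List.length_cons]
    simp only [isRise_iff_of_nodup h, ite_not]
    split_ifs
    · omega
    · rw [List.length_cons]; omega

theorem sum_descents_add_nonBottoms_aux {a : ℕ} {w : List ℕ} (h : (a :: w).Nodup) :
    ∑ i ∈ descents (a :: w), (a :: w).getD (i + 1) 0 + (nonBottoms a w).sum = w.sum := by
  induction w generalizing a with
  | nil => simp [descents, nonBottoms]
  | cons b w ih =>
    have ih := ih h.of_cons
    have hab : a ≠ b := by
      simp only [List.nodup_cons, List.mem_cons, not_or] at h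
      exact h.1.1
    rw [sum_descents_cons, nonBottoms, List.sum_cons, ← ih]
    simp only [List.getD_cons_succ, List.getD_cons_zero, List.length_cons]
    by_cases h1 : a < b
    · rw [if_pos h1, if_neg (by omega), List.sum_cons]
      omega
    · rw [if_neg h1, if_pos (by omega)]
      omega

/-- Every letter is a descent bottom or not; positivity makes the first letter a non-bottom relative
to the fictitious predecessor `0`. -/
theorem sum_descents_add_nonBottoms {w : List ℕ} (h : w.Nodup) (hpos : ∀ a ∈ w, 0 < a) :
    ∑ i ∈ descents w, w.getD (i + 1) 0 + (nonBottoms 0 w).sum = w.sum := by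
  cases w with
  | nil => simp [descents, nonBottoms]
  | cons a w =>
    rw [nonBottoms, if_pos (hpos a (by simp)), List.sum_cons, List.sum_cons,
      ← sum_descents_add_nonBottoms_aux h]
    omega

/-! ### The reverse complement -/

/-- The reverse complement of a permutation. -/
def reverseComplement (w : List ℕ) : List ℕ := complement (reversal w)

theorem bigTheta_eq (w : List ℕ) :
    bigTheta w = reverseComplement (theta (reverseComplement w)) := rfl

@[simp] theorem length_reverseComplement (w : List ℕ) :
    (reverseComplement w).length = w.length := by
  simp [reverseComplement, complement, reversal]

theorem getD_reverseComplement {w : List ℕ} {i : ℕ} (hi : i < w.length) :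
    (reverseComplement w).getD i 0 = w.length + 1 - w.getD (w.length - 1 - i) 0 := by
  rw [List.getD_eq_getElem _ _ (by simpa using hi), List.getD_eq_getElem _ _ (by omega)]
  simp [reverseComplement, complement, reversal]

theorem reverseComplement_perm {w : List ℕ} {n : ℕ} (hp : w.Perm (List.range' 1 n)) :
    (reverseComplement w).Perm (List.range' 1 n) := by
  have hlen : w.length = n := by simpa using hp.length_eq
  simp only [reverseComplement, complement, reversal, List.length_reverse, hlen]
  refine (((List.reverse_perm w).trans hp).map _).trans ?_
  rw [List.perm_ext_iff_of_nodup _ (List.nodup_range' ..)]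
  · intro j
    simp only [List.mem_map, List.mem_range'_1]
    constructor
    · rintro ⟨a, h, rfl⟩; omega
    · intro h; exact ⟨n + 1 - j, by omega, by omega⟩
  · refine List.Nodup.map_on ?_ (List.nodup_range' ..)
    intro x hx y hy
    rw [List.mem_range'_1] at hx hy
    omega

theorem reverseComplement_reverseComplement {w : List ℕ} {n : ℕ}
    (hp : w.Perm (List.range' 1 n)) : reverseComplement (reverseComplement w) = w := by
  have hlen : w.length = n := by simpa using hp.length_eq
  simp only [reverseComplement, complement, reversal, List.length_reverse, List.length_map, hlen,
    ← List.map_reverse, List.reverse_reverse, List.map_map]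
  conv_rhs => rw [← List.map_id w]
  refine List.map_congr_left fun x hx => ?_
  have := hp.mem_iff.1 hx
  rw [List.mem_range'_1] at this
  simp only [Function.comp, id]
  omega

theorem avoids231_iff {w : List ℕ} :
    Avoids231 w ↔ ∀ i j k, i < j → j < k → k < w.length →
      ¬ (w.getD k 0 < w.getD i 0 ∧ w.getD i 0 < w.getD j 0) := by
  induction w with
  | nil => simp [Avoids231]
  | cons a w ih =>
    rw [Avoids231, ih, List.pairwise_iff_getElem]
    constructor
    · rintro ⟨h1, h2⟩ i j k hij hjk hk
      obtain ⟨j, rfl⟩ : ∃ j', j = j' + 1 := ⟨j - 1, by omega⟩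
      obtain ⟨k, rfl⟩ : ∃ k', k = k' + 1 := ⟨k - 1, by omega⟩
      have hk' : k < w.length := by simpa using hk
      cases i with
      | zero =>
        have := h1 j k (by omega) hk' (by omega)
        rw [← List.getD_eq_getElem _ 0, ← List.getD_eq_getElem _ 0] at this
        simpa using this
      | succ i =>
        simpa using h2 i j k (by omega) (by omega) hk'
    · intro h
      refine ⟨fun j k hj hk hjk => ?_, fun i j k hij hjk hk => ?_⟩
      · have := h 0 (j + 1) (k + 1) (by omega) (by omega) (by simpa using hk)
        rw [← List.getD_eq_getElem _ 0, ← List.getD_eq_getElem _ 0]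
        simpa using this
      · simpa using h (i + 1) (j + 1) (k + 1) (by omega) (by omega) (by simpa using hk)

theorem avoids231_reverseComplement {w : List ℕ} {n : ℕ} (hp : w.Perm (List.range' 1 n)) :
    Avoids231 (reverseComplement w) ↔ Avoids [3, 1, 2] w := by
  have hlen : w.length = n := by simpa using hp.length_eq
  rw [avoids231_iff, avoids_312_iff, length_reverseComplement]
  constructor
  · intro h i j k hij hjk hk hh
    have := h (w.length - 1 - k) (w.length - 1 - j) (w.length - 1 - i) (by omega) (by omega)
      (by omega)
    rw [getD_reverseComplement (by omega), getD_reverseComplement (by omega),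
      getD_reverseComplement (by omega), show w.length - 1 - (w.length - 1 - k) = k by omega,
      show w.length - 1 - (w.length - 1 - j) = j by omega,
      show w.length - 1 - (w.length - 1 - i) = i by omega] at this
    have h1 := getD_bounds hp (i := i) (by omega)
    have h2 := getD_bounds hp (i := j) (by omega)
    have h3 := getD_bounds hp (i := k) (by omega)
    omega
  · intro h i j k hij hjk hk hh
    rw [getD_reverseComplement (by omega), getD_reverseComplement (by omega),
      getD_reverseComplement (by omega)] at hh
    exact h (w.length - 1 - k) (w.length - 1 - j) (w.length - 1 - i) (by omega) (by omega)
      (by omega) (by omega)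

/-- Reversal sends the neighbouring positions `i, i + 1`, counted from `0`, to `n - 1 - i, n - 2 -
i`; complementation restores the descent, which now starts at `n - 2 - i`. -/
theorem sum_descents_reverseComplement {w : List ℕ} {n : ℕ} (hp : w.Perm (List.range' 1 n))
    (f : ℕ → ℕ) :
    ∑ i ∈ descents (reverseComplement w), f i = ∑ i ∈ descents w, f (w.length - 2 - i) := by
  refine Finset.sum_nbij' (fun i => w.length - 2 - i) (fun i => w.length - 2 - i) ?_ ?_ ?_ ?_ ?_
  · intro i hi
    simp only [descents, Finset.mem_filter, Finset.mem_range, length_reverseComplement] at hi ⊢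
    rw [getD_reverseComplement (by omega), getD_reverseComplement (by omega),
      show w.length - 1 - (i + 1) = w.length - 2 - i by omega,
      show w.length - 1 - i = w.length - 2 - i + 1 by omega] at hi
    omega
  · intro i hi
    simp only [descents, Finset.mem_filter, Finset.mem_range, length_reverseComplement] at hi ⊢
    rw [getD_reverseComplement (by omega), getD_reverseComplement (by omega),
      show w.length - 1 - (w.length - 2 - i + 1) = i by omega,
      show w.length - 1 - (w.length - 2 - i) = i + 1 by omega]
    have h1 := getD_bounds hp hi.1
    have h2 := getD_bounds hp hi.2.1
    have hlen : w.length = n := by simpa using hp.length_eq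
    omega
  · intro i hi
    simp only [descents, Finset.mem_filter, length_reverseComplement] at hi
    omega
  · intro i hi
    simp only [descents, Finset.mem_filter] at hi
    omega
  · intro i hi
    simp only [descents, Finset.mem_filter, length_reverseComplement] at hi
    congr 1
    omega

/-! ### The map `Θ` -/

theorem mem_avoidersOfLength {n : ℕ} {w : List ℕ} :
    w ∈ avoidersOfLength n [3, 1, 2] ↔
      w.Perm (List.range' 1 n) ∧ Avoids231 (reverseComplement w) := by
  rw [avoidersOfLength, Finset.mem_filter, mem_permWords]
  exact and_congr_right fun hp => (avoids231_reverseComplement hp).symm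

theorem bigTheta_mem {n : ℕ} {w : List ℕ} (hw : w ∈ avoidersOfLength n [3, 1, 2]) :
    bigTheta w ∈ avoidersOfLength n [3, 1, 2] := by
  obtain ⟨hp, h⟩ := mem_avoidersOfLength.1 hw
  have t := isRiseTransfer_theta h (reverseComplement_perm hp)
  have hp' := t.perm.trans (reverseComplement_perm hp)
  rw [mem_avoidersOfLength, bigTheta_eq, reverseComplement_reverseComplement hp']
  exact ⟨reverseComplement_perm hp', t.avoids⟩

theorem bijOn_bigTheta (n : ℕ) :
    Set.BijOn bigTheta (avoidersOfLength n [3, 1, 2]) (avoidersOfLength n [3, 1, 2]) := by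
  have hmaps : Set.MapsTo bigTheta (avoidersOfLength n [3, 1, 2] : Set (List ℕ))
      (avoidersOfLength n [3, 1, 2]) := fun w hw => bigTheta_mem hw
  have hinj : Set.InjOn bigTheta (avoidersOfLength n [3, 1, 2] : Set (List ℕ)) := by
    intro w hw v hv e
    obtain ⟨hp, h⟩ := mem_avoidersOfLength.1 hw
    obtain ⟨hp', h'⟩ := mem_avoidersOfLength.1 hv
    have q := reverseComplement_perm hp
    have q' := reverseComplement_perm hp'
    rw [bigTheta_eq, bigTheta_eq] at e
    have e1 := congrArg reverseComplement e
    rw [reverseComplement_reverseComplement ((isRiseTransfer_theta h q).perm.trans q),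
      reverseComplement_reverseComplement ((isRiseTransfer_theta h' q').perm.trans q')] at e1
    have e2 := congrArg reverseComplement (theta_injOn h h' q q' e1)
    rwa [reverseComplement_reverseComplement hp, reverseComplement_reverseComplement hp'] at e2
  exact ⟨hmaps, hinj, Finset.surjOn_of_injOn_of_card_le _ hmaps hinj le_rfl⟩

theorem bast_eq_foze_bigTheta {n : ℕ} (hpos : 1 ≤ n) {w : List ℕ}
    (hw : w ∈ avoidersOfLength n [3, 1, 2]) : bast w = foze (bigTheta w) := by
  have hv := bigTheta_mem hw
  obtain ⟨hp, h⟩ := mem_avoidersOfLength.1 hw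
  obtain ⟨hpv, hv'⟩ := mem_avoidersOfLength.1 hv
  have q := reverseComplement_perm hp
  have t := isRiseTransfer_theta h q
  have q' := t.perm.trans q
  have hav := (avoids231_reverseComplement hp).1 h
  have havv := (avoids231_reverseComplement hpv).1 hv'
  obtain ⟨u, hu⟩ : ∃ u, u = reverseComplement w := ⟨_, rfl⟩
  obtain ⟨v, hθ⟩ : ∃ v, v = theta u := ⟨_, rfl⟩
  have hwu : w = reverseComplement u := by rw [hu, reverseComplement_reverseComplement hp]
  have hΘ : bigTheta w = reverseComplement v := by rw [bigTheta_eq, hθ, hu]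
  rw [← hu] at q t q'
  rw [← hθ] at t q'
  have hlu : u.length = n := by simpa using q.length_eq
  have hlv : v.length = n := by simpa using q'.length_eq
  have hnu : u.Nodup := q.nodup_iff.2 (List.nodup_range' ..)
  have hnv : v.Nodup := q'.nodup_iff.2 (List.nodup_range' ..)
  rw [bast_eq (hp.nodup_iff.2 (List.nodup_range' ..)) hav, foze_eq hpv]
  -- the number of descents
  have hdes : ∀ {x : List ℕ}, x.Perm (List.range' 1 n) →
      (descents (reverseComplement x)).card = (descents x).card := fun hx => by
    rw [Finset.card_eq_sum_ones, Finset.card_eq_sum_ones,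
      sum_descents_reverseComplement hx (fun _ => 1)]
  have hcard : (descents w).card = (descents (bigTheta w)).card := by
    have h1 := card_descents_add_riseLetters hnu
    have h2 := card_descents_add_riseLetters hnv
    rw [t.letters] at h2
    rw [hΘ, hwu, hdes q, hdes q']
    omega
  -- the first letter
  have hfirst : w.getD 0 0 = (bigTheta w).getD 0 0 := by
    have hlast : v.getLast? = u.getLast? := by
      rw [← getLast?_riseLetters v, ← getLast?_riseLetters u, t.letters]
    rw [hΘ, hwu, getD_reverseComplement (by omega), getD_reverseComplement (by omega), hlu, hlv]
    rw [List.getLast?_eq_getElem?, List.getLast?_eq_getElem?, hlu, hlv] at hlast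
    simp [List.getD_eq_getElem?_getD, hlast]
  have hocc := occ_132_add hp hpos hav
  have hocc' := occ_132_add hpv hpos havv
  -- the descent positions and the descent bottoms
  have hsum : ∑ i ∈ descents w, (w.length - 1 - i) =
      ∑ i ∈ descents (bigTheta w), (n + 1 - (bigTheta w).getD i 0) := by
    have h1 := sum_descents_add_risePositions hnu 1
    have h2 := sum_descents_add_nonBottoms hnv fun a ha => by
      have := q'.mem_iff.1 ha
      rw [List.mem_range'_1] at this
      omega
    rw [t.positions.sum_eq, q'.sum_eq] at h2
    rw [hlu] at h1
    have h3 : ∑ i ∈ descents w, (w.length - 1 - i) = ∑ i ∈ descents u, (i + 1) := by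
      rw [hwu, sum_descents_reverseComplement q, length_reverseComplement]
      refine Finset.sum_congr rfl fun i hi => ?_
      simp only [descents, Finset.mem_filter] at hi
      omega
    have h4 : ∑ i ∈ descents (bigTheta w), (n + 1 - (bigTheta w).getD i 0) =
        ∑ i ∈ descents v, v.getD (i + 1) 0 := by
      rw [hΘ, sum_descents_reverseComplement q']
      refine Finset.sum_congr rfl fun i hi => ?_
      simp only [descents, Finset.mem_filter] at hi
      have := getD_bounds q' hi.2.1
      rw [getD_reverseComplement (by omega),
        show v.length - 1 - (v.length - 2 - i) = i + 1 by omega, hlv]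
      omega
    omega
  omega

end PermStat
open PermStat

theorem theorem3 :
    Set.BijOn bigTheta (Av [3, 1, 2]) (Av [3, 1, 2]) ∧
    (∀ n : ℕ, 1 ≤ n →
      Set.BijOn bigTheta (avoidersOfLength n [3, 1, 2]) (avoidersOfLength n [3, 1, 2])) ∧
    (∀ w ∈ Av [3, 1, 2], bast w = foze (bigTheta w)) ∧
    (∀ n : ℕ, 1 ≤ n →
      (∑ w ∈ avoidersOfLength n [3, 1, 2], (Polynomial.X : Polynomial ℕ) ^ bast w) =
        ∑ w ∈ avoidersOfLength n [3, 1, 2], (Polynomial.X : Polynomial ℕ) ^ foze w) := by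
  refine ⟨⟨?_, ?_, ?_⟩, fun n _ => bijOn_bigTheta n, ?_, ?_⟩
  · rintro w ⟨n, hn, hw⟩
    exact ⟨n, hn, bigTheta_mem hw⟩
  · rintro w ⟨n, _, hw⟩ v ⟨m, _, hv⟩ e
    have length_eq : ∀ {k : ℕ} {x : List ℕ}, x ∈ avoidersOfLength k [3, 1, 2] → x.length = k :=
      fun hx => by simpa using (mem_avoidersOfLength.1 hx).1.length_eq
    -- Equal images have equal lengths and `bigTheta` preserves length, which reduces injectivity on
    -- `Av` to a single length.
    obtain rfl : n = m := by
      rw [← length_eq (bigTheta_mem hw), ← length_eq (bigTheta_mem hv), e]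
    exact (bijOn_bigTheta n).injOn hw hv e
  · rintro w ⟨n, hn, hw⟩
    obtain ⟨v, hv, e⟩ := (bijOn_bigTheta n).surjOn hw
    exact ⟨v, ⟨n, hn, hv⟩, e⟩
  · rintro w ⟨n, hn, hw⟩
    exact bast_eq_foze_bigTheta hn hw
  · intro n hn
    have hb := bijOn_bigTheta n
    refine Finset.sum_nbij bigTheta (fun w hw => hb.mapsTo hw) hb.injOn hb.surjOn fun w hw => ?_
    rw [bast_eq_foze_bigTheta hn hw]
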